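/- Let $S$ be a commutative ring, $\mathbf G$ an abelian group, $n\ge 0$, and let $R=S[X_1,\dots,X_n]$ be $\mathbf G$-graded by $\deg X_i=\gamma_i\in\mathbf G$ and $\deg s=0$ for $s\in S$. Regard $S=R/(X_1,\dots,X_n)$ as an $R$-module. Let $B\subseteq (X_1,\dots,X_n)$ be a finitely generated homogeneous ideal and let $M$ be a $\mathbf G$-graded $R$-module (not necessarily finitely generated). Write $H^i_B(M)$ for the $i$-th local cohomology module, i.e. the $i$-th cohomology of the Čech complex $0\to M\to\bigoplus_k M_{f_k}\to\bigoplus_{k<l}M_{f_kf_l}\to\cdots$ on any finite system $f_1,\dots,f_s$ of homogeneous generators of $B$; it is $\mathbf G$-graded. The $\mathbf G$-grading of $\operatorname{Tor}^R_j(M,S)$ is the one induced by any graded free resolution of $M$. For a graded module $N$ put $\operatorname{Supp}_{\mathbf G}(N)=\{\gamma\in\mathbf G : N_\gamma\ne 0\}$. For $l\ge 0$ put $$\mathcal E_l=\{\gamma_{i_1}+\cdots+\gamma_{i_l} : i_1<\cdots<i_l\}$$ (so $\mathcal E_0=\{0\}$, and $\mathcal E_l=\emptyset$ for $l>n$), and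 let $\mathcal C\subseteq\mathbf G$ be the monoid generated by $\gamma_1,\dots,\gamma_n$. Define $$\operatorname{reg}(M)=\Big\{\gamma\in\mathbf G :\ \gamma'\notin\bigcup_{i\ge 0}\big(\operatorname{Supp}_{\mathbf G}(H^i_B(M))+\mathcal E_i\big)\ \text{ for all }\gamma'\in\gamma+\mathcal C\Big\}.$$ **Theorem.** For every $j\ge 0$, $$\bigcap_{\gamma\in\mathcal E_j}\big(\operatorname{reg}(M)+\gamma\big)\ \cap\ \operatorname{Supp}_{\mathbf G}\big(\operatorname{Tor}^R_j(M,S)\big)=\emptyset ,$$ where the intersection over an empty $\mathcal E_j$ is $\mathbf G$. Moreover, suppose that $\mathbf G=\mathbb Z$ and the grading is standard ($\gamma_i=1$ for all $i$). For a $\mathbb Z$-graded module $N$ let $\operatorname{end}(N)=\sup\{\mu : N_\mu\neq 0\}\in\mathbb Z\cup\{\pm\infty\}$ (with $\operatorname{end}(0)=-\infty$), and let $\operatorname{reg}(M)$ now denote the Castelnuovo–Mumford regularity $\sup_{i\ge 0}\{\operatorname{end}(H^i_B(M))+i\}\in\mathbb Z\cup\{\pm\infty\}$, which for $B=(X_1,\dots,X_n)$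 is the usual one. Then for every $j\ge 0$ $$\operatorname{reg}(M)+j\ \ge\ \operatorname{end}\big(\operatorname{Tor}^R_j(M,S)\big).$$ -/

import Mathlib

open scoped Pointwise TensorProduct

universe u v x y

noncomputable section

/-! ### Graded modules over `S[X₁, …, Xₙ]` with `deg Xᵢ = w i`, and their supports -/

section Graded

variable {G : Type*} [AddCommGroup G] {n : ℕ}

/-- `ℳ` makes `M` a `G`-graded module over `R = S[X₁, …, Xₙ]`, where `R` carries the `G`-grading
with `deg Xᵢ = w i` and `deg s = 0` for `s ∈ S`: one has `M = ⨁ ℳ γ` and `R_α ℳ_β ⊆ ℳ_{α + β}`. -/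
structure IsGradedModule (S : Type*) [CommRing S] (w : Fin n → G) {M : Type*} [AddCommGroup M]
    [Module (MvPolynomial (Fin n) S) M] (ℳ : G → AddSubgroup M) : Prop where
  smul_mem : ∀ (α β : G) (r : MvPolynomial (Fin n) S) (m : M),
    r ∈ MvPolynomial.weightedHomogeneousSubmodule S w α → m ∈ ℳ β → r • m ∈ ℳ (α + β)
  isInternal : by classical exact DirectSum.IsInternal ℳ

/-- The support `Supp_G(N) = {γ : N_γ ≠ 0}` of a module with homogeneous components `𝒩 γ`. -/
def gradedSupport {N : Type*} [AddCommGroup N] (𝒩 : G → AddSubgroup N) : Set G :=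
  {γ | 𝒩 γ ≠ ⊥}

/-- `ℰ_l`: the set of all sums `γ_{i₁} + ⋯ + γ_{i_l}` with `i₁ < ⋯ < i_l`. -/
def sumsOfDistinct (w : Fin n → G) (l : ℕ) : Set G :=
  {g | ∃ I : Finset (Fin n), I.card = l ∧ g = ∑ i ∈ I, w i}

/-- The monoid `𝒞` generated by `γ₁, …, γₙ`. -/
def degreeMonoid (w : Fin n → G) : AddSubmonoid G :=
  AddSubmonoid.closure (Set.range w)

end Graded

/-! ### Local cohomology through the Čech complex -/

section Cech

variable {R : Type*} [CommRing R] {M : Type*} [AddCommGroup M] [Module R M]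

theorem isUnit_algebraMap_end_of_dvd {a b : R} (h : a ∣ b) (x : Submonoid.powers a) :
    IsUnit ((algebraMap R (Module.End R (LocalizedModule (Submonoid.powers b) M))) x) := by
  obtain ⟨_, k, rfl⟩ := x
  obtain ⟨c, rfl⟩ := h
  have hb := IsLocalizedModule.map_units
    (LocalizedModule.mkLinearMap (Submonoid.powers (a * c)) M)
    (⟨a * c, 1, by simp⟩ : Submonoid.powers (a * c))
  simp only [map_mul] at hb
  have hc : Commute ((algebraMap R (Module.End R (LocalizedModule (Submonoid.powers (a * c)) M))) a)
      ((algebraMap R (Module.End R (LocalizedModule (Submonoid.powers (a * c)) M))) c) :=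
    Algebra.commute_algebraMap_left _ _
  simpa using (hc.isUnit_mul_iff.1 hb).1.pow k

/-- The canonical map `M_a → M_b` for `a ∣ b`. -/
def localizationMap (M : Type*) [AddCommGroup M] [Module R M] (a b : R) (h : a ∣ b) :
    LocalizedModule (Submonoid.powers a) M →ₗ[R] LocalizedModule (Submonoid.powers b) M :=
  LocalizedModule.lift (Submonoid.powers a)
    (LocalizedModule.mkLinearMap (Submonoid.powers b) M) (isUnit_algebraMap_end_of_dvd h)

variable {s : ℕ}

/-- The Čech cochains `C^p = ⨁_{i₁ < ⋯ < i_p} M_{f_{i₁} ⋯ f_{i_p}}`. -/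
abbrev CechCochain (f : Fin s → R) (M : Type*) [AddCommGroup M] [Module R M] (p : ℕ) : Type _ :=
  (I : {I : Finset (Fin s) // I.card = p}) →
    LocalizedModule (Submonoid.powers (∏ i ∈ I.1, f i)) M

/-- The subset `J ∖ {k}` of cardinality `p`. -/
def eraseIndex {p : ℕ} (J : {J : Finset (Fin s) // J.card = p + 1}) (k : {k // k ∈ J.1}) :
    {I : Finset (Fin s) // I.card = p} :=
  ⟨J.1.erase k.1, by rw [Finset.card_erase_of_mem k.2, J.2]; rfl⟩

theorem prod_eraseIndex_dvd (f : Fin s → R) {p : ℕ}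
    (J : {J : Finset (Fin s) // J.card = p + 1}) (k : {k // k ∈ J.1}) :
    (∏ i ∈ (eraseIndex J k).1, f i) ∣ ∏ i ∈ J.1, f i :=
  Finset.prod_dvd_prod_of_subset _ _ _ (Finset.erase_subset _ _)

/-- The Čech differential `C^p → C^{p+1}`: for `J = {j₀ < ⋯ < j_p}`,
`(d c)_J = ∑ₜ (-1)^t c_{J ∖ {j_t}}`, the sum taken in `M_{f_J}`. -/
def cechDifferential (f : Fin s → R) (M : Type*) [AddCommGroup M] [Module R M] (p : ℕ) :
    CechCochain f M p →ₗ[R] CechCochain f M (p + 1) :=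
  LinearMap.pi fun J => ∑ k : {k // k ∈ J.1},
    ((-1 : R) ^ (J.1.filter (· < k.1)).card) •
      (localizationMap M _ _ (prod_eraseIndex_dvd f J k) ∘ₗ LinearMap.proj (eraseIndex J k))

/-- The Čech coboundaries in `C^p` (zero for `p = 0`). -/
def cechCoboundaries (f : Fin s → R) (M : Type*) [AddCommGroup M] [Module R M] :
    (p : ℕ) → Submodule R (CechCochain f M p)
  | 0 => ⊥
  | p + 1 => LinearMap.range (cechDifferential f M p)

/-- The local cohomology module `H^p_B(M)` with support in `B = (f₁, …, f_s)`: the cohomology of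
the Čech complex `0 → M → ⨁ M_{f_i} → ⨁ M_{f_i f_j} → ⋯ → M_{f₁ ⋯ f_s} → 0`. -/
abbrev CechCohomology (f : Fin s → R) (M : Type*) [AddCommGroup M] [Module R M] (p : ℕ) : Type _ :=
  LinearMap.ker (cechDifferential f M p) ⧸
    (cechCoboundaries f M p).comap (LinearMap.ker (cechDifferential f M p)).subtype

variable {G : Type*} [AddCommGroup G]

/-- The component of degree `γ` of `M_a`, for `a` homogeneous of degree `δ`: the additive subgroup
generated by the fractions `m / a^k` with `m` homogeneous of degree `γ + k δ`. -/
def localizedComponent (ℳ : G → AddSubgroup M) (a : R) (δ : G) (γ : G) :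
    AddSubgroup (LocalizedModule (Submonoid.powers a) M) :=
  AddSubgroup.closure {x | ∃ (k : ℕ) (m : M), m ∈ ℳ (γ + k • δ) ∧
    x = LocalizedModule.mk m (⟨a ^ k, k, rfl⟩ : Submonoid.powers a)}

/-- The component of degree `γ` of the Čech cochains, for `f i` homogeneous of degree `d i`. -/
def cechComponent (f : Fin s → R) (d : Fin s → G) (ℳ : G → AddSubgroup M) (p : ℕ) (γ : G) :
    AddSubgroup (CechCochain f M p) :=
  AddSubgroup.pi Set.univ fun I =>
    localizedComponent ℳ (∏ i ∈ I.1, f i) (∑ i ∈ I.1, d i) γ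

/-- The component `H^p_B(M)_γ`: the classes of the cocycles that are homogeneous of degree `γ`. -/
def cohomologyComponent (f : Fin s → R) (d : Fin s → G) (ℳ : G → AddSubgroup M) (p : ℕ) (γ : G) :
    AddSubgroup (CechCohomology f M p) :=
  ((cechComponent f d ℳ p γ).comap
    (LinearMap.ker (cechDifferential f M p)).subtype.toAddMonoidHom).map
    (Submodule.mkQ _).toAddMonoidHom

end Cech

/-! ### Graded Tor -/

section Tor

variable {G : Type*} [AddCommGroup G] {n : ℕ}

/-- A `G`-graded free resolution `⋯ → F₁ → F₀ → M → 0` of a graded module `M`: every `Fᵢ` is a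
graded module with a basis of homogeneous elements, and all maps preserve degrees. -/
structure GradedFreeResolution (S : Type u) [CommRing S] (w : Fin n → G) {M : Type*} [AddCommGroup M]
    [Module (MvPolynomial (Fin n) S) M] (ℳ : G → AddSubgroup M) where
  F : ℕ → Type v
  [addCommGroup : ∀ i, AddCommGroup (F i)]
  [module : ∀ i, Module (MvPolynomial (Fin n) S) (F i)]
  component : ∀ i, G → AddSubgroup (F i)
  isGraded : ∀ i, IsGradedModule S w (component i)
  exists_basis : ∀ i, ∃ (ι : Type v) (b : Module.Basis ι (MvPolynomial (Fin n) S) (F i)),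
    ∀ k, ∃ γ, b k ∈ component i γ
  d : ∀ i, F (i + 1) →ₗ[MvPolynomial (Fin n) S] F i
  d_mem : ∀ i γ, ∀ x ∈ component (i + 1) γ, d i x ∈ component i γ
  ε : F 0 →ₗ[MvPolynomial (Fin n) S] M
  ε_mem : ∀ γ, ∀ x ∈ component 0 γ, ε x ∈ ℳ γ
  ε_surjective : Function.Surjective ε
  exact_zero : Function.Exact (d 0) ε
  exact_succ : ∀ i, Function.Exact (d (i + 1)) (d i)

attribute [instance] GradedFreeResolution.addCommGroup GradedFreeResolution.module

/-- `S` as a module over `R = S[X₁, …, Xₙ]`, that is, `R / (X₁, …, Xₙ)`. -/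
abbrev CoeffModule (S : Type u) [CommRing S] (n : ℕ) : Type u :=
  MvPolynomial (Fin n) S ⧸
    Ideal.span (Set.range (MvPolynomial.X : Fin n → MvPolynomial (Fin n) S))

variable {S : Type u} [CommRing S] {w : Fin n → G} {M : Type*} [AddCommGroup M] [Module (MvPolynomial (Fin n) S) M]
  {ℳ : G → AddSubgroup M}

namespace GradedFreeResolution

variable (P : GradedFreeResolution.{u, v} S w ℳ)

/-- The `j`-th term `F_j ⊗_R S`. -/
abbrev TensorTerm (j : ℕ) : Type _ :=
  P.F j ⊗[MvPolynomial (Fin n) S] CoeffModule S n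

/-- The differential `F_{j+1} ⊗_R S → F_j ⊗_R S`. -/
def tensorD (j : ℕ) : P.TensorTerm (j + 1) →ₗ[MvPolynomial (Fin n) S] P.TensorTerm j :=
  (P.d j).rTensor (CoeffModule S n)

/-- The cycles in `F_j ⊗_R S` (everything for `j = 0`). -/
def torCycles : (j : ℕ) → Submodule (MvPolynomial (Fin n) S) (P.TensorTerm j)
  | 0 => ⊤
  | j + 1 => LinearMap.ker (P.tensorD j)

/-- `Tor_j^R(M, S) = H_j(F ⊗_R S)`. -/
abbrev Tor (j : ℕ) : Type _ :=
  P.torCycles j ⧸ (LinearMap.range (P.tensorD j)).comap (P.torCycles j).subtype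

/-- The component of degree `γ` of `F_j ⊗_R S`: generated by the tensors `x ⊗ r` of homogeneous
elements with `deg x + deg r = γ`. -/
def tensorComponent (j : ℕ) (γ : G) : AddSubgroup (P.TensorTerm j) :=
  AddSubgroup.closure {t | ∃ (α β : G) (x : P.F j) (r : MvPolynomial (Fin n) S),
    α + β = γ ∧ x ∈ P.component j α ∧ r ∈ MvPolynomial.weightedHomogeneousSubmodule S w β ∧
    t = x ⊗ₜ[MvPolynomial (Fin n) S] (Ideal.Quotient.mk _ r : CoeffModule S n)}

/-- The component `Tor_j^R(M, S)_γ`: the classes of the cycles that are homogeneous of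
degree `γ`. -/
def torComponent (j : ℕ) (γ : G) : AddSubgroup (P.Tor j) :=
  ((P.tensorComponent j γ).comap (P.torCycles j).subtype.toAddMonoidHom).map
    (Submodule.mkQ _).toAddMonoidHom

end GradedFreeResolution

end Tor

/-! ### Regularity -/

section Regularity

variable {S G : Type*} [CommRing S] [AddCommGroup G] {n s : ℕ}
  {M : Type*} [AddCommGroup M] [Module (MvPolynomial (Fin n) S) M]

/-- `M` is weakly `γ`-regular with respect to `B = (f₁, …, f_s)`, where `deg f_i = d i`:
`γ ∉ ⋃ᵢ (Supp_G(H^i_B(M)) + ℰ_i)`. -/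
def IsWeaklyRegular (w : Fin n → G) (f : Fin s → MvPolynomial (Fin n) S) (d : Fin s → G)
    (ℳ : G → AddSubgroup M) (γ : G) : Prop :=
  γ ∉ ⋃ i : ℕ, gradedSupport (cohomologyComponent f d ℳ i) + sumsOfDistinct w i

/-- The regularity region `reg(M)`: all `γ` such that `M` is weakly `γ'`-regular for every
`γ' ∈ γ + 𝒞`. -/
def regularityRegion (w : Fin n → G) (f : Fin s → MvPolynomial (Fin n) S) (d : Fin s → G)
    (ℳ : G → AddSubgroup M) : Set G :=
  {γ | ∀ γ' ∈ ({γ} : Set G) + (degreeMonoid w : Set G), IsWeaklyRegular w f d ℳ γ'}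

/-- `end(N) = sup {μ : N_μ ≠ 0}` of a `ℤ`-graded module, in `ℤ ∪ {±∞}`; it is `-∞` for `N = 0`. -/
def gradedEnd {N : Type*} [AddCommGroup N] (𝒩 : ℤ → AddSubgroup N) : WithBot (WithTop ℤ) :=
  ⨆ μ ∈ gradedSupport 𝒩, ((μ : WithTop ℤ) : WithBot (WithTop ℤ))

/-- The Castelnuovo-Mumford regularity `sup_i (a_i(M) + i)`, with `a_i(M) = end(H^i_B(M))`,
of a `ℤ`-graded module, in `ℤ ∪ {±∞}`. -/
def regularityNumber (f : Fin s → MvPolynomial (Fin n) S) (d : Fin s → ℤ)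
    (ℳ : ℤ → AddSubgroup M) : WithBot (WithTop ℤ) :=
  ⨆ i : ℕ, gradedEnd (cohomologyComponent f d ℳ i) + (i : WithBot (WithTop ℤ))

end Regularity

end

noncomputable section

/-! ### The Koszul complex on all subsets of the index set at once -/

section Koszul

/-! The heart of the matter is a statement about single degrees: if `Tor_j(M, S)_γ ≠ 0`, then
`H^p_B(M)` is nonzero in degree `γ - ∑ i ∈ Q, w i` for some `p` and some `Q` with `p + j` elements
(`exists_cohomologyComponent_ne_bot`). Both assertions follow by bookkeeping. Split `Q` into `J`
with `j` elements and a rest with `p` elements. If `γ = ρ + ∑ i ∈ J, w i`, then `ρ` lies in `Supp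
H^p_B(M) + ℰ_p`, so `ρ ∉ reg(M)`. For the standard grading, `γ - p - j ≤ end H^p_B(M)`.

Its contrapositive passes through the Koszul complex `K` of the variables, and needs only vanishing,
in a fixed degree `γ`; each spectral sequence argument becomes a diagram chase.

Koszul against Čech: since `B ⊆ (X₁, …, Xₙ)`, inverting a product of some `f i` makes an element of
`(X₁, …, Xₙ)` act bijectively, which contracts `K` (`exists_koszulD_eq_of_homotopy`). So only the
Čech column `p = 0`, which is `M`, can carry Koszul homology. If the relevant components of
`H^p_B(M)` vanish, so does the Koszul homology of `M` in bidegree `(j, γ)`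
(`isKoszulExact_of_cohomologyComponent_eq_bot`).

Koszul against a free resolution `F`: the variables form a regular sequence on each `F i`, so `K ⊗ F
i` is exact in positive Koszul degree (`exists_koszulD_eq_of_regular`). A chase through `K ⊗ F` then
turns exactness of `K ⊗ M` at `(j, γ)` into `Tor_j(M, S)_γ = 0` (`torComponent_eq_bot`). -/

theorem Finset.sum_sum_eq_zero_of_alternating {ι A : Type*} [Fintype ι] [AddCommGroup A]
    (a : ι → ι → A) (h0 : ∀ k, a k k = 0) (h : ∀ k l, k ≠ l → a k l + a l k = 0) :
    ∑ k, ∑ l, a k l = 0 := by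
  classical
  rw [← Fintype.sum_prod_type']
  refine Finset.sum_involution (fun p _ => p.swap) ?_ ?_ (fun _ _ => Finset.mem_univ _) (by simp)
  · rintro ⟨k, l⟩ -
    by_cases hkl : k = l
    · subst hkl; simp [h0]
    · exact h k l hkl
  · rintro ⟨k, l⟩ - hne heq
    simp only [Prod.swap_prod_mk, Prod.mk.injEq] at heq
    exact hne (by rw [heq.1]; exact h0 _)

variable {n : ℕ}

/-- The sign `(-1)^#{i ∈ Q : i < k}`. -/
def positionSign (R : Type*) [CommRing R] (k : Fin n) (Q : Finset (Fin n)) : R :=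
  (-1) ^ (Q.filter (· < k)).card

variable {R : Type*} [CommRing R]

theorem positionSign_empty (k : Fin n) : positionSign R k ∅ = 1 := by simp [positionSign]

theorem positionSign_mul_self (k : Fin n) (Q : Finset (Fin n)) :
    positionSign R k Q * positionSign R k Q = 1 := by
  rw [positionSign, ← mul_pow]; simp

theorem positionSign_insert {l : Fin n} {Q : Finset (Fin n)} (hl : l ∉ Q) (k : Fin n) :
    positionSign R k (insert l Q) = if l < k then -positionSign R k Q else positionSign R k Q := by
  unfold positionSign
  rw [Finset.filter_insert]
  split_ifs
  · rw [Finset.card_insert_of_notMem (by simp [hl]), pow_succ]; ring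
  · rfl

/-- Exactly one of the two insertions lies below the other index, so exactly one of the two signs
flips. -/
theorem positionSign_insert_mul {k l : Fin n} {Q : Finset (Fin n)} (hk : k ∉ Q) (hl : l ∉ Q)
    (hkl : k ≠ l) :
    positionSign R k Q * positionSign R l (insert k Q) =
      -(positionSign R l Q * positionSign R k (insert l Q)) := by
  rw [positionSign_insert hk, positionSign_insert hl]
  rcases lt_or_gt_of_ne hkl with h | h
  · rw [if_pos h, if_neg h.not_gt]; ring
  · rw [if_neg h.not_gt, if_pos h]; ring

variable {N : Type*} [AddCommGroup N] [Module R N]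

/-- Contraction with the `k`-th coordinate form. -/
def contract (R : Type*) [CommRing R] {N : Type*} [AddCommGroup N] [Module R N] (k : Fin n) :
    (Finset (Fin n) → N) →ₗ[R] (Finset (Fin n) → N) where
  toFun c Q := if k ∈ Q then 0 else positionSign R k Q • c (insert k Q)
  map_add' c c' := by ext Q; by_cases h : k ∈ Q <;> simp [h]
  map_smul' r c := by ext Q; by_cases h : k ∈ Q <;> simp [h, smul_comm r]

/-- Left multiplication by the `k`-th basis vector. -/
def wedge (R : Type*) [CommRing R] {N : Type*} [AddCommGroup N] [Module R N] (k : Fin n) :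
    (Finset (Fin n) → N) →ₗ[R] (Finset (Fin n) → N) where
  toFun c Q := if k ∈ Q then positionSign R k (Q.erase k) • c (Q.erase k) else 0
  map_add' c c' := by ext Q; by_cases h : k ∈ Q <;> simp [h]
  map_smul' r c := by ext Q; by_cases h : k ∈ Q <;> simp [h, smul_comm r]

theorem contract_of_mem {k : Fin n} {Q : Finset (Fin n)} (h : k ∈ Q) (c : Finset (Fin n) → N) :
    contract R k c Q = 0 := if_pos h

theorem contract_of_notMem {k : Fin n} {Q : Finset (Fin n)} (h : k ∉ Q)
    (c : Finset (Fin n) → N) :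
    contract R k c Q = positionSign R k Q • c (insert k Q) := if_neg h

theorem wedge_of_mem {k : Fin n} {Q : Finset (Fin n)} (h : k ∈ Q) (c : Finset (Fin n) → N) :
    wedge R k c Q = positionSign R k (Q.erase k) • c (Q.erase k) := if_pos h

theorem wedge_insert {k : Fin n} {Q : Finset (Fin n)} (h : k ∉ Q) (c : Finset (Fin n) → N) :
    wedge R k c (insert k Q) = positionSign R k Q • c Q := by
  rw [wedge_of_mem (Finset.mem_insert_self _ _), Finset.erase_insert h]

theorem wedge_of_notMem {k : Fin n} {Q : Finset (Fin n)} (h : k ∉ Q) (c : Finset (Fin n) → N) :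
    wedge R k c Q = 0 := if_neg h

theorem contract_contract_self (k : Fin n) (c : Finset (Fin n) → N) :
    contract R k (contract R k c) = 0 := by
  ext Q
  by_cases h : k ∈ Q
  · rw [contract_of_mem h]; rfl
  · rw [contract_of_notMem h, contract_of_mem (Finset.mem_insert_self _ _), smul_zero]; rfl

theorem contract_contract_add {k l : Fin n} (hkl : k ≠ l) (c : Finset (Fin n) → N) :
    contract R k (contract R l c) + contract R l (contract R k c) = 0 := by
  ext Q
  rw [Pi.add_apply, Pi.zero_apply]
  by_cases hk : k ∈ Q
  · rw [contract_of_mem hk, zero_add]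
    by_cases hl : l ∈ Q
    · rw [contract_of_mem hl]
    · rw [contract_of_notMem hl, contract_of_mem (Finset.mem_insert_of_mem hk), smul_zero]
  · by_cases hl : l ∈ Q
    · rw [contract_of_mem hl, add_zero, contract_of_notMem hk,
        contract_of_mem (Finset.mem_insert_of_mem hl), smul_zero]
    · rw [contract_of_notMem hk, contract_of_notMem hl, contract_of_notMem (by simp [hl, hkl.symm]),
        contract_of_notMem (by simp [hk, hkl]), smul_smul, smul_smul,
        positionSign_insert_mul hk hl hkl, Finset.insert_comm, neg_smul, neg_add_cancel]

theorem contract_wedge_self (k : Fin n) (c : Finset (Fin n) → N) :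
    contract R k (wedge R k c) + wedge R k (contract R k c) = c := by
  ext Q
  rw [Pi.add_apply]
  by_cases hk : k ∈ Q
  · rw [contract_of_mem hk, wedge_of_mem hk, contract_of_notMem (Finset.notMem_erase _ _),
      Finset.insert_erase hk, smul_smul, positionSign_mul_self, one_smul, zero_add]
  · rw [contract_of_notMem hk, wedge_of_notMem hk, wedge_insert hk, smul_smul,
      positionSign_mul_self, one_smul, add_zero]

/-- With `contract_contract_add` and `contract_wedge_self`, these are the Clifford relations; all
identities for the Koszul differential are formal consequences of them. -/
theorem contract_wedge_add {k l : Fin n} (hkl : k ≠ l) (c : Finset (Fin n) → N) :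
    contract R k (wedge R l c) + wedge R l (contract R k c) = 0 := by
  ext Q
  rw [Pi.add_apply, Pi.zero_apply]
  by_cases hl : l ∈ Q
  · obtain ⟨T, hT, rfl⟩ : ∃ T, l ∉ T ∧ insert l T = Q :=
      ⟨Q.erase l, Finset.notMem_erase _ _, Finset.insert_erase hl⟩
    rw [wedge_insert hT]
    by_cases hk : k ∈ T
    · rw [contract_of_mem (Finset.mem_insert_of_mem hk), contract_of_mem hk, smul_zero, add_zero]
    · rw [contract_of_notMem (by simp [hk, hkl]), contract_of_notMem hk, Finset.insert_comm,
        wedge_insert (by simp [hT, hkl.symm]), smul_smul, smul_smul,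
        positionSign_insert hT, positionSign_insert hk, ← add_smul]
      rcases lt_or_gt_of_ne hkl with h | h
      · rw [if_neg h.not_gt, if_pos h]; convert zero_smul R _; ring
      · rw [if_pos h, if_neg h.not_gt]; convert zero_smul R _; ring
  · rw [wedge_of_notMem hl, add_zero]
    by_cases hk : k ∈ Q
    · rw [contract_of_mem hk]
    · rw [contract_of_notMem hk, wedge_of_notMem (by simp [hl, hkl.symm]), smul_zero]

/-- The Koszul differential for the sequence `a`. -/
def koszulD (a : Fin n → R) (N : Type*) [AddCommGroup N] [Module R N] :
    (Finset (Fin n) → N) →ₗ[R] (Finset (Fin n) → N) :=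
  ∑ k, a k • contract R k

theorem koszulD_apply (a : Fin n → R) (c : Finset (Fin n) → N) :
    koszulD a N c = ∑ k, a k • contract R k c := by
  simp [koszulD]

theorem koszulD_koszulD (a : Fin n → R) (c : Finset (Fin n) → N) :
    koszulD a N (koszulD a N c) = 0 := by
  simp only [koszulD_apply, map_sum, map_smul, Finset.smul_sum]
  refine Finset.sum_sum_eq_zero_of_alternating _ (fun k => ?_) (fun k l hkl => ?_)
  · rw [contract_contract_self, smul_zero, smul_zero]
  · rw [smul_comm (a l), ← smul_add, ← smul_add, contract_contract_add hkl.symm, smul_zero, smul_zero]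

theorem contract_koszulD (a : Fin n → R) (l : Fin n) (c : Finset (Fin n) → N) :
    contract R l (koszulD a N c) = -koszulD a N (contract R l c) := by
  rw [eq_neg_iff_add_eq_zero]
  simp only [koszulD_apply, map_sum, map_smul, ← Finset.sum_add_distrib, ← smul_add]
  refine Finset.sum_eq_zero fun k _ => ?_
  by_cases hkl : l = k
  · subst hkl; rw [contract_contract_self, add_zero, smul_zero]
  · rw [contract_contract_add hkl, smul_zero]

/-- Wedging with the `l`-th basis vector is a homotopy between `a l` and zero; this is the source of
both exactness results. -/
theorem koszulD_wedge (a : Fin n → R) (l : Fin n) (c : Finset (Fin n) → N) :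
    koszulD a N (wedge R l c) + wedge R l (koszulD a N c) = a l • c := by
  simp only [koszulD_apply, map_sum, map_smul, ← Finset.sum_add_distrib, ← smul_add]
  rw [Finset.sum_eq_single l]
  · rw [contract_wedge_self]
  · intro k _ hk; rw [contract_wedge_add hk, smul_zero]
  · simp

theorem koszulD_comp {N' : Type*} [AddCommGroup N'] [Module R N'] (a : Fin n → R) (φ : N →ₗ[R] N')
    (c : Finset (Fin n) → N) :
    koszulD a N' (fun Q => φ (c Q)) = fun Q => φ (koszulD a N c Q) := by
  ext Q
  simp only [koszulD_apply, Finset.sum_apply, Pi.smul_apply, map_sum, map_smul]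
  refine Finset.sum_congr rfl fun k _ => ?_
  by_cases hk : k ∈ Q
  · rw [contract_of_mem hk, contract_of_mem hk, map_zero]
  · rw [contract_of_notMem hk, contract_of_notMem hk, map_smul]

theorem koszulD_apply_empty (a : Fin n → R) (c : Finset (Fin n) → N) :
    koszulD a N c ∅ = ∑ k, a k • c {k} := by
  simp only [koszulD_apply, Finset.sum_apply, Pi.smul_apply]
  refine Finset.sum_congr rfl fun k _ => ?_
  rw [contract_of_notMem (Finset.notMem_empty _), positionSign_empty, one_smul]
  rfl

end Koszul

/-! ### Homogeneous Koszul chains -/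

section KoszulDegree

variable {n : ℕ} {R : Type*} [CommRing R] {N : Type*} [AddCommGroup N] [Module R N]
  {G : Type*} [AddCommGroup G]

/-- The Koszul chains of homological degree `q` and internal degree `γ`. -/
def koszulComponent (w : Fin n → G) (𝒩 : G → AddSubgroup N) (q : ℕ) (γ : G) :
    AddSubgroup (Finset (Fin n) → N) where
  carrier := {c | ∀ Q, (Q.card = q → c Q ∈ 𝒩 (γ - ∑ i ∈ Q, w i)) ∧ (Q.card ≠ q → c Q = 0)}
  add_mem' ha hb Q := ⟨fun h => add_mem ((ha Q).1 h) ((hb Q).1 h),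
    fun h => by rw [Pi.add_apply, (ha Q).2 h, (hb Q).2 h, add_zero]⟩
  zero_mem' Q := ⟨fun _ => zero_mem _, fun _ => rfl⟩
  neg_mem' ha Q := ⟨fun h => neg_mem ((ha Q).1 h), fun h => by
    rw [Pi.neg_apply, (ha Q).2 h, neg_zero]⟩

variable {w : Fin n → G} {𝒩 : G → AddSubgroup N} {q : ℕ} {γ : G}

theorem positionSign_smul_mem {H : AddSubgroup N} {m : N} (hm : m ∈ H) (k : Fin n)
    (Q : Finset (Fin n)) : positionSign R k Q • m ∈ H := by
  unfold positionSign
  rcases neg_one_pow_eq_or R (Q.filter (· < k)).card with h | h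
  · rwa [h, one_smul]
  · rw [h, neg_smul, one_smul]; exact neg_mem hm

theorem contract_mem_koszulComponent {c : Finset (Fin n) → N}
    (hc : c ∈ koszulComponent w 𝒩 (q + 1) γ) (k : Fin n) :
    contract R k c ∈ koszulComponent w 𝒩 q (γ - w k) := by
  intro Q
  by_cases hk : k ∈ Q
  · rw [contract_of_mem hk]; exact ⟨fun _ => zero_mem _, fun _ => rfl⟩
  · rw [contract_of_notMem hk]
    refine ⟨fun h => positionSign_smul_mem ?_ _ _, fun h => ?_⟩
    · have := (hc (insert k Q)).1 (by rw [Finset.card_insert_of_notMem hk, h])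
      rwa [Finset.sum_insert hk, ← sub_sub] at this
    · rw [(hc (insert k Q)).2 (by rw [Finset.card_insert_of_notMem hk]; omega), smul_zero]

theorem wedge_mem_koszulComponent {c : Finset (Fin n) → N}
    (hc : c ∈ koszulComponent w 𝒩 q γ) (k : Fin n) :
    wedge R k c ∈ koszulComponent w 𝒩 (q + 1) (γ + w k) := by
  intro Q
  by_cases hk : k ∈ Q
  · obtain ⟨T, hT, rfl⟩ : ∃ T, k ∉ T ∧ insert k T = Q :=
      ⟨Q.erase k, Finset.notMem_erase _ _, Finset.insert_erase hk⟩
    rw [wedge_insert hT, Finset.card_insert_of_notMem hT, Finset.sum_insert hT]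
    refine ⟨fun h => positionSign_smul_mem ?_ _ _, fun h => ?_⟩
    · convert (hc T).1 (by omega) using 2; abel
    · rw [(hc T).2 (by omega), smul_zero]
  · rw [wedge_of_notMem hk]; exact ⟨fun _ => zero_mem _, fun _ => rfl⟩

theorem smul_mem_koszulComponent {c : Finset (Fin n) → N} (hc : c ∈ koszulComponent w 𝒩 q γ)
    {α : G} {r : R} (hr : ∀ β, ∀ m ∈ 𝒩 β, r • m ∈ 𝒩 (α + β)) :
    r • c ∈ koszulComponent w 𝒩 q (α + γ) := by
  intro Q
  refine ⟨fun h => ?_, fun h => ?_⟩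
  · rw [add_sub_assoc]; exact hr _ _ ((hc Q).1 h)
  · rw [Pi.smul_apply, (hc Q).2 h, smul_zero]

theorem koszulD_mem_koszulComponent {a : Fin n → R}
    (ha : ∀ k β, ∀ m ∈ 𝒩 β, a k • m ∈ 𝒩 (w k + β)) {c : Finset (Fin n) → N}
    (hc : c ∈ koszulComponent w 𝒩 (q + 1) γ) : koszulD a N c ∈ koszulComponent w 𝒩 q γ := by
  rw [koszulD_apply]
  refine sum_mem fun k _ => ?_
  have := smul_mem_koszulComponent (contract_mem_koszulComponent (R := R) hc k) (ha k)
  rwa [add_sub_cancel] at this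

theorem koszulD_eq_zero {a : Fin n → R} {c : Finset (Fin n) → N}
    (hc : c ∈ koszulComponent w 𝒩 0 γ) : koszulD a N c = 0 := by
  rw [koszulD_apply]
  refine Finset.sum_eq_zero fun k _ => ?_
  convert smul_zero _
  ext Q
  by_cases hk : k ∈ Q
  · rw [contract_of_mem hk]; rfl
  · rw [contract_of_notMem hk, (hc _).2 (by rw [Finset.card_insert_of_notMem hk]; omega),
      smul_zero]; rfl

/-- The chain of homological degree `0` with value `m`. -/
def koszulSingle (m : N) : Finset (Fin n) → N := Pi.single ∅ m

theorem koszulSingle_mem {m : N} (hm : m ∈ 𝒩 γ) :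
    (koszulSingle m : Finset (Fin n) → N) ∈ koszulComponent w 𝒩 0 γ := by
  intro Q
  by_cases hQ : Q = ∅
  · subst hQ; simpa [koszulSingle] using hm
  · simp [koszulSingle, hQ]

theorem eq_koszulSingle {c : Finset (Fin n) → N} (hc : c ∈ koszulComponent w 𝒩 0 γ) :
    c = koszulSingle (c ∅) := by
  ext Q
  by_cases hQ : Q = ∅
  · subst hQ; simp [koszulSingle]
  · rw [(hc Q).2 (by simpa using hQ)]; simp [koszulSingle, hQ]

theorem contract_koszulSingle (k : Fin n) (m : N) : contract R k (koszulSingle m) = 0 := by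
  ext Q
  by_cases hk : k ∈ Q
  · rw [contract_of_mem hk]; rfl
  · rw [contract_of_notMem hk]; simp [koszulSingle]

theorem koszulD_wedge_koszulSingle (a : Fin n → R) (k : Fin n) (m : N) :
    koszulD a N (wedge R k (koszulSingle m)) = koszulSingle (a k • m) := by
  have h := koszulD_wedge a k (koszulSingle m : Finset (Fin n) → N)
  rw [koszulD_apply a (koszulSingle m)] at h
  simp only [contract_koszulSingle, smul_zero, Finset.sum_const_zero, map_zero, add_zero] at h
  rw [h]
  ext Q
  by_cases hQ : Q = ∅
  · subst hQ; simp [koszulSingle]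
  · simp [koszulSingle, hQ]

theorem koszulSingle_sum {ι : Type*} (t : Finset ι) (m : ι → N) :
    (koszulSingle (∑ i ∈ t, m i) : Finset (Fin n) → N) = ∑ i ∈ t, koszulSingle (m i) := by
  ext Q
  by_cases hQ : Q = ∅
  · subst hQ; simp [koszulSingle]
  · simp [koszulSingle, hQ]

/-- A homogeneous form of weak regularity: `a m` is a nonzerodivisor modulo the previous ones. -/
def IsGradedWeaklyRegular (a : Fin n → R) (w : Fin n → G) (𝒩 : G → AddSubgroup N) : Prop :=
  ∀ (m : Fin n) (γ : G), ∀ b ∈ 𝒩 γ, (∃ c : Fin n → N, a m • b = ∑ k ∈ Finset.Iio m, a k • c k) →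
    ∃ c : Fin n → N, (∀ k, c k ∈ 𝒩 (γ - w k)) ∧ b = ∑ k ∈ Finset.Iio m, a k • c k

/-- Induction on the number `m` of elements of the sequence in play: vanishing of the contractions
with all `k ≥ m` says that the chain lives on subsets of the first `m` indices. -/
theorem exists_koszulD_eq_of_contract_eq_zero {a : Fin n → R}
    (ha : ∀ k β, ∀ m ∈ 𝒩 β, a k • m ∈ 𝒩 (w k + β)) (hreg : IsGradedWeaklyRegular a w 𝒩) (m : ℕ) :
    ∀ (q : ℕ) (γ : G), ∀ z ∈ koszulComponent w 𝒩 (q + 1) γ,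
      (∀ k : Fin n, m ≤ k → contract R k z = 0) → koszulD a N z = 0 →
      ∃ y ∈ koszulComponent w 𝒩 (q + 2) γ,
        (∀ k : Fin n, m ≤ k → contract R k y = 0) ∧ koszulD a N y = z := by
  induction m with
  | zero =>
    intro q γ z hz hk _
    -- All contractions of `z` vanish, so `z` is supported on `∅`; its homological degree is
    -- positive, so `z = 0`.
    refine ⟨0, zero_mem _, fun _ _ => map_zero _, ?_⟩
    rw [map_zero]
    ext Q
    rcases Q.eq_empty_or_nonempty with rfl | ⟨k, hkQ⟩
    · exact ((hz ∅).2 (by simp)).symm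
    · have := congrFun (hk k (Nat.zero_le _)) (Q.erase k)
      rw [contract_of_notMem (Finset.notMem_erase _ _), Finset.insert_erase hkQ] at this
      have h2 := congrArg (positionSign R k (Q.erase k) • ·) this
      simp only [smul_smul, positionSign_mul_self, one_smul, Pi.zero_apply, smul_zero] at h2
      rw [h2]; rfl
  | succ m ih =>
    intro q γ z hz hzk hdz
    by_cases hm : n ≤ m
    · obtain ⟨y, hy, -, hyz⟩ := ih q γ z hz (fun k hk => absurd k.2 (by omega)) hdz
      exact ⟨y, hy, fun k hk => absurd k.2 (by omega), hyz⟩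
    push Not at hm
    obtain ⟨M, hM⟩ : ∃ M : Fin n, (M : ℕ) = m := ⟨⟨m, hm⟩, rfl⟩
    -- Write `z = c + e_M ∧ b` with `b` and `c` free of the index `M`. Then `dz = 0` splits into `db
    -- = 0` and `dc = -a_M b`.
    set b := contract R M z with hb
    have hbmem : b ∈ koszulComponent w 𝒩 q (γ - w M) := contract_mem_koszulComponent hz M
    have hbk : ∀ k : Fin n, m ≤ k → contract R k b = 0 := by
      intro k hk
      by_cases hkM : k = M
      · rw [hkM, hb, contract_contract_self]
      · have hlt : m + 1 ≤ k := by
          have : (k : ℕ) ≠ m := fun h => hkM (Fin.ext (h.trans hM.symm))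
          omega
        have := contract_contract_add (R := R) hkM z
        rwa [hzk k hlt, map_zero, add_zero] at this
    have hdb : koszulD a N b = 0 := by
      have := contract_koszulD a M z
      rw [hdz, map_zero] at this
      exact neg_eq_zero.1 this.symm
    set c := contract R M (wedge R M z) with hc
    have hcz : c + wedge R M b = z := contract_wedge_self M z
    have hcmem : c ∈ koszulComponent w 𝒩 (q + 1) γ := by
      have := contract_mem_koszulComponent (R := R) (wedge_mem_koszulComponent (R := R) hz M) M
      rwa [add_sub_cancel_right] at this
    have hck : ∀ k : Fin n, m ≤ k → contract R k c = 0 := by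
      intro k hk
      by_cases hkM : k = M
      · rw [hkM, hc, contract_contract_self]
      · have hlt : m + 1 ≤ k := by
          have : (k : ℕ) ≠ m := fun h => hkM (Fin.ext (h.trans hM.symm))
          omega
        have h1 := contract_wedge_add (R := R) hkM b
        rw [hbk k hk, map_zero, add_zero] at h1
        rw [eq_sub_of_add_eq hcz, map_sub, hzk k hlt, h1, sub_zero]
    have hdc : koszulD a N c = -(a M • b) := by
      have h1 := koszulD_wedge a M b
      rw [hdb, map_zero, add_zero] at h1
      rw [eq_sub_of_add_eq hcz, map_sub, hdz, h1, zero_sub]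
    -- The cycle `b` is a boundary: by induction in positive degree; in degree `0` because `a_M b =
    -- -dc` lies in the span of the earlier `a_k`, which is where regularity enters.
    obtain ⟨b', hb', hb'k, hb'b⟩ : ∃ b' ∈ koszulComponent w 𝒩 (q + 1) (γ - w M),
        (∀ k : Fin n, m ≤ k → contract R k b' = 0) ∧ koszulD a N b' = b := by
      rcases q with _ | q
      · have hbe : b ∅ ∈ 𝒩 (γ - w M) := by simpa using (hbmem ∅).1 rfl
        obtain ⟨e, he, hbe⟩ := hreg M _ _ hbe ⟨fun k => -c {k}, by
          have h1 := congrFun hdc ∅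
          rw [koszulD_apply_empty, Pi.neg_apply, Pi.smul_apply] at h1
          simp only [smul_neg, Finset.sum_neg_distrib]
          rw [← neg_eq_iff_eq_neg.2 h1]
          congr 1
          symm
          refine Finset.sum_subset (Finset.subset_univ _) fun k _ hk => ?_
          have := congrFun (hck k (by simpa [hM, Fin.le_def] using hk)) ∅
          rw [contract_of_notMem (Finset.notMem_empty _), positionSign_empty, one_smul] at this
          exact (congrArg (a k • ·) this).trans (smul_zero _)⟩
        refine ⟨∑ k ∈ Finset.Iio M, wedge R k (koszulSingle (e k)), sum_mem fun k _ => ?_,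
          fun l hl => ?_, ?_⟩
        · have := wedge_mem_koszulComponent (R := R) (koszulSingle_mem (w := w) (he k)) k
          rwa [sub_add_cancel] at this
        · rw [map_sum]
          refine Finset.sum_eq_zero fun k hk => ?_
          have hlk : l ≠ k := by
            rintro rfl
            have := Finset.mem_Iio.1 hk
            rw [Fin.lt_def] at this
            omega
          have := contract_wedge_add (R := R) hlk (koszulSingle (e k))
          rwa [contract_koszulSingle, map_zero, add_zero] at this
        · simp only [map_sum, koszulD_wedge_koszulSingle]
          rw [← koszulSingle_sum, ← hbe, ← eq_koszulSingle hbmem]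
      · exact ih q _ b hbmem hbk hdb
    have h1 := koszulD_wedge a M b'
    rw [hb'b] at h1
    -- Now `c + a_M b'` is a cycle on the first `m` indices, say `dy`; since `d(e_M ∧ b') = a_M b' -
    -- e_M ∧ b`, the chain `y - e_M ∧ b'` bounds `z`.
    obtain ⟨y, hy, hyk, hyz⟩ := ih q γ (c + a M • b')
      (add_mem hcmem (by
        have := smul_mem_koszulComponent hb' (ha M)
        rwa [add_sub_cancel] at this))
      (fun k hk => by rw [map_add, map_smul, hck k hk, hb'k k hk, smul_zero, add_zero])
      (by rw [map_add, map_smul, hb'b, hdc, neg_add_cancel])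
    refine ⟨y - wedge R M b', sub_mem hy ?_, fun k hk => ?_, ?_⟩
    · have := wedge_mem_koszulComponent (R := R) hb' M
      rwa [sub_add_cancel] at this
    · have hkM : k ≠ M := by rintro rfl; omega
      have h2 := contract_wedge_add (R := R) hkM b'
      rw [hb'k k (by omega), map_zero, add_zero] at h2
      rw [map_sub, hyk k (by omega), h2, sub_zero]
    · rw [map_sub, hyz, ← hcz, ← h1]; abel

/-- The Koszul complex of a regular sequence is exact in positive homological degrees. -/
theorem exists_koszulD_eq_of_regular {a : Fin n → R}
    (ha : ∀ k β, ∀ m ∈ 𝒩 β, a k • m ∈ 𝒩 (w k + β)) (hreg : IsGradedWeaklyRegular a w 𝒩)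
    {z : Finset (Fin n) → N} (hz : z ∈ koszulComponent w 𝒩 (q + 1) γ) (hdz : koszulD a N z = 0) :
    ∃ y ∈ koszulComponent w 𝒩 (q + 2) γ, koszulD a N y = z := by
  obtain ⟨y, hy, -, h⟩ := exists_koszulD_eq_of_contract_eq_zero ha hreg n q γ z hz
    (fun k hk => absurd k.2 (by omega)) hdz
  exact ⟨y, hy, h⟩

/-- If `∑ a k * e k` acts bijectively and homogeneously, the Koszul complex is exact. -/
theorem exists_koszulD_eq_of_homotopy {a e : Fin n → R} {δ : G}
    (he : ∀ k β, ∀ m ∈ 𝒩 β, e k • m ∈ 𝒩 (δ - w k + β))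
    (hinv : ∀ β, ∀ m ∈ 𝒩 β, ∃ m' ∈ 𝒩 (β - δ), (∑ k, e k * a k) • m' = m)
    (hinj : ∀ m : N, (∑ k, e k * a k) • m = 0 → m = 0)
    {z : Finset (Fin n) → N} (hz : z ∈ koszulComponent w 𝒩 q γ) (hdz : koszulD a N z = 0) :
    ∃ y ∈ koszulComponent w 𝒩 (q + 1) γ, koszulD a N y = z := by
  -- Divide `z` by `∑ e_k a_k`, choosing `0` outside cardinality `q`; by injectivity the quotient is
  -- again a cycle.
  have hex : ∀ Q : Finset (Fin n), ∃ m' : N, (∑ k, e k * a k) • m' = z Q ∧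
      (Q.card = q → m' ∈ 𝒩 (γ - δ - ∑ i ∈ Q, w i)) ∧ (Q.card ≠ q → m' = 0) := by
    intro Q
    by_cases h : Q.card = q
    · obtain ⟨m', hm', h'⟩ := hinv _ _ ((hz Q).1 h)
      refine ⟨m', h', fun _ => ?_, fun h2 => absurd h h2⟩
      rwa [sub_right_comm]
    · exact ⟨0, by rw [smul_zero, (hz Q).2 h], fun h2 => absurd h2 h, fun _ => rfl⟩
  choose z' hz'1 hz'2 using hex
  have hz'z : (∑ k, e k * a k) • z' = z := funext hz'1
  have hmem : z' ∈ koszulComponent w 𝒩 q (γ - δ) := hz'2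
  have hdz' : koszulD a N z' = 0 := by
    ext Q
    refine hinj _ ?_
    rw [← Pi.smul_apply, ← map_smul, hz'z, hdz]; rfl
  refine ⟨∑ k, e k • wedge R k z', sum_mem fun k _ => ?_, ?_⟩
  · have := smul_mem_koszulComponent (wedge_mem_koszulComponent (R := R) hmem k) (he k)
    rwa [show δ - w k + (γ - δ + w k) = γ by abel] at this
  · rw [map_sum, ← hz'z, Finset.sum_smul]
    refine Finset.sum_congr rfl fun k _ => ?_
    have := koszulD_wedge a k z'
    rw [hdz', map_zero, add_zero] at this
    rw [map_smul, this, smul_smul]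

end KoszulDegree

/-! ### Graded modules: projections onto components -/

section GradedModule

variable {G : Type*} [AddCommGroup G] {n : ℕ} {S : Type*} [CommRing S] {w : Fin n → G}
  {M : Type*} [AddCommGroup M] [Module (MvPolynomial (Fin n) S) M] {ℳ : G → AddSubgroup M}

/-- The exactness of the Koszul complex of the variables on `N` in bidegree `(q, γ)`. -/
def IsKoszulExact (S : Type*) [CommRing S] (w : Fin n → G) {N : Type*} [AddCommGroup N]
    [Module (MvPolynomial (Fin n) S) N] (𝒩 : G → AddSubgroup N) (q : ℕ) (γ : G) : Prop :=
  ∀ z ∈ koszulComponent w 𝒩 q γ,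
    koszulD (MvPolynomial.X : Fin n → MvPolynomial (Fin n) S) N z = 0 →
    ∃ y ∈ koszulComponent w 𝒩 (q + 1) γ,
      koszulD (MvPolynomial.X : Fin n → MvPolynomial (Fin n) S) N y = z

theorem IsGradedModule.X_smul_mem (h : IsGradedModule S w ℳ) (k : Fin n) (β : G) (m : M)
    (hm : m ∈ ℳ β) : (MvPolynomial.X k : MvPolynomial (Fin n) S) • m ∈ ℳ (w k + β) :=
  h.smul_mem _ _ _ _ (MvPolynomial.isWeightedHomogeneous_X S w k) hm

theorem IsGradedModule.induction (h : IsGradedModule S w ℳ) {p : M → Prop} (h0 : p 0)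
    (hadd : ∀ a b, p a → p b → p (a + b)) (hmem : ∀ γ, ∀ m ∈ ℳ γ, p m) (m : M) : p m := by
  classical
  obtain ⟨c, rfl⟩ := h.isInternal.2 m
  induction c using DirectSum.induction_on with
  | zero => simpa using h0
  | of i x => simpa using hmem i x x.2
  | add a b ha hb => rw [map_add]; exact hadd _ _ ha hb

theorem IsGradedModule.exists_proj (h : IsGradedModule S w ℳ) :
    ∃ π : G → M →+ M, (∀ γ m, π γ m ∈ ℳ γ) ∧ (∀ γ, ∀ m ∈ ℳ γ, π γ m = m) ∧
      ∀ β γ, β ≠ γ → ∀ m ∈ ℳ β, π γ m = 0 := by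
  classical
  let := h.isInternal.chooseDecomposition
  refine ⟨fun γ => (AddSubgroup.subtype _).comp ((DFinsupp.evalAddMonoidHom γ).comp
    (DirectSum.decomposeAddEquiv ℳ).toAddMonoidHom), fun γ m => SetLike.coe_mem _,
    fun γ m hm => DirectSum.decompose_of_mem_same ℳ hm,
    fun β γ hne m hm => DirectSum.decompose_of_mem_ne ℳ hm hne⟩

/-- The projection of a graded module onto its component of degree `γ`. -/
def IsGradedModule.proj (h : IsGradedModule S w ℳ) (γ : G) : M →+ M := h.exists_proj.choose γ

theorem IsGradedModule.proj_mem (h : IsGradedModule S w ℳ) (γ : G) (m : M) : h.proj γ m ∈ ℳ γ :=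
  h.exists_proj.choose_spec.1 γ m

theorem IsGradedModule.proj_same (h : IsGradedModule S w ℳ) {γ : G} {m : M} (hm : m ∈ ℳ γ) :
    h.proj γ m = m :=
  h.exists_proj.choose_spec.2.1 γ m hm

theorem IsGradedModule.proj_ne (h : IsGradedModule S w ℳ) {β γ : G} (hne : β ≠ γ) {m : M}
    (hm : m ∈ ℳ β) : h.proj γ m = 0 :=
  h.exists_proj.choose_spec.2.2 β γ hne m hm

theorem IsGradedModule.proj_map (h : IsGradedModule S w ℳ) {w' : Fin n → G}
    {M' : Type*} [AddCommGroup M']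
    [Module (MvPolynomial (Fin n) S) M'] {ℳ' : G → AddSubgroup M'} (h' : IsGradedModule S w' ℳ')
    {α : G} (φ : M →+ M') (hφ : ∀ γ, ∀ m ∈ ℳ γ, φ m ∈ ℳ' (α + γ)) (γ : G) (m : M) :
    h'.proj (α + γ) (φ m) = φ (h.proj γ m) := by
  refine h.induction (p := fun m => h'.proj (α + γ) (φ m) = φ (h.proj γ m)) (by simp) (fun a b ha hb => by simp [ha, hb]) (fun β m hm => ?_) m
  by_cases hβ : β = γ
  · subst hβ; rw [h.proj_same hm, h'.proj_same (hφ _ _ hm)]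
  · rw [h.proj_ne hβ hm, h'.proj_ne (by simpa using hβ) (hφ _ _ hm), map_zero]

theorem IsGradedModule.proj_smul (h : IsGradedModule S w ℳ) {α : G} {r : MvPolynomial (Fin n) S}
    (hr : MvPolynomial.IsWeightedHomogeneous w r α) (γ : G) (m : M) :
    h.proj (α + γ) (r • m) = r • h.proj γ m :=
  h.proj_map h (DistribSMul.toAddMonoidHom M r) (fun _ _ hm => h.smul_mem _ _ _ _ hr hm) γ m

/-- Any preimage may be replaced by its homogeneous part, because `φ` commutes with the projections.
-/
theorem IsGradedModule.exists_mem_map_eq (h : IsGradedModule S w ℳ)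
    {M' : Type*} [AddCommGroup M']
    [Module (MvPolynomial (Fin n) S) M'] {ℳ' : G → AddSubgroup M'} (h' : IsGradedModule S w ℳ')
    (φ : M →ₗ[MvPolynomial (Fin n) S] M') (hφ : ∀ γ, ∀ m ∈ ℳ γ, φ m ∈ ℳ' γ) (γ : G) (m' : M')
    (hm' : m' ∈ ℳ' γ) (hr : m' ∈ LinearMap.range φ) : ∃ m ∈ ℳ γ, φ m = m' := by
  obtain ⟨m, rfl⟩ := hr
  refine ⟨h.proj γ m, h.proj_mem _ _, ?_⟩
  have := h.proj_map h' (α := 0) φ.toAddMonoidHom (by simpa using hφ) γ m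
  rw [zero_add] at this
  exact this.symm.trans (h'.proj_same hm')

theorem IsGradedModule.exists_homogeneous_coeff (h : IsGradedModule S w ℳ) {t : Finset (Fin n)}
    {γ : G} {y : M} (hy : y ∈ ℳ γ) {c : Fin n → M}
    (hc : y = ∑ k ∈ t, (MvPolynomial.X k : MvPolynomial (Fin n) S) • c k) :
    ∃ c' : Fin n → M, (∀ k, c' k ∈ ℳ (γ - w k)) ∧
      y = ∑ k ∈ t, (MvPolynomial.X k : MvPolynomial (Fin n) S) • c' k := by
  refine ⟨fun k => h.proj (γ - w k) (c k), fun k => h.proj_mem _ _, ?_⟩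
  rw [← h.proj_same hy, hc, map_sum]
  refine Finset.sum_congr rfl fun k _ => ?_
  have := h.proj_smul (MvPolynomial.isWeightedHomogeneous_X S w k) (γ - w k) (c k)
  rwa [add_sub_cancel] at this

/-- The polynomial ring as a graded module over itself. -/
theorem isGradedModule_mvPolynomial (S : Type*) [CommRing S] (w : Fin n → G) :
    IsGradedModule S w
      (fun γ => (MvPolynomial.weightedHomogeneousSubmodule S w γ).toAddSubgroup) where
  smul_mem α β r m hr hm := MvPolynomial.IsWeightedHomogeneous.mul hr hm
  isInternal := by
    classical
    let := MvPolynomial.weightedDecomposition S w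
    exact DirectSum.Decomposition.isInternal (MvPolynomial.weightedHomogeneousSubmodule S w)

theorem exists_sum_smul_of_mem_span_smul_top {R N : Type*} [CommRing R] [AddCommGroup N]
    [Module R N] (a : Fin n → R) (t : Finset (Fin n)) {y : N}
    (hy : y ∈ Ideal.span (a '' t) • (⊤ : Submodule R N)) :
    ∃ c : Fin n → N, y = ∑ k ∈ t, a k • c k := by
  classical
  let φ : (Fin n → N) →ₗ[R] N := ∑ k ∈ t, a k • LinearMap.proj k
  have hφ : ∀ c, φ c = ∑ k ∈ t, a k • c k := fun c => by simp [φ]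
  have hle : Ideal.span (a '' t) • (⊤ : Submodule R N) ≤ LinearMap.range φ := by
    rw [Submodule.smul_le]
    intro r hr m _
    have : Ideal.span (a '' t) ≤ Submodule.comap (LinearMap.toSpanSingleton R N m)
        (LinearMap.range φ) := by
      rw [Ideal.span, Submodule.span_le]
      rintro _ ⟨k, hk, rfl⟩
      refine ⟨Pi.single k m, ?_⟩
      rw [hφ, Finset.sum_eq_single k]
      · simp
      · intro l _ hl; simp [hl]
      · exact fun h => absurd hk h
    exact this hr
  obtain ⟨c, rfl⟩ := hle hy
  exact ⟨c, hφ c⟩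

theorem exists_sum_smul_of_mem_span_range {R N : Type*} [CommRing R] [AddCommGroup N]
    [Module R N] (a : Fin n → R) {y : N}
    (hy : y ∈ Ideal.span (Set.range a) • (⊤ : Submodule R N)) :
    ∃ c : Fin n → N, y = ∑ k, a k • c k :=
  exists_sum_smul_of_mem_span_smul_top a Finset.univ (by simpa using hy)

/-- Membership in a monomial ideal is tested on monomials, and multiplication by `X m` leaves the
exponents of the variables in `s` unchanged. -/
theorem MvPolynomial.mem_span_X_image_of_X_mul_mem {σ : Type*} {s : Set σ} {m : σ} (hm : m ∉ s)
    {p : MvPolynomial σ S} (h : MvPolynomial.X m * p ∈ Ideal.span (MvPolynomial.X '' s)) :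
    p ∈ Ideal.span (MvPolynomial.X '' s : Set (MvPolynomial σ S)) := by
  classical
  rw [MvPolynomial.mem_ideal_span_X_image] at h ⊢
  intro d hd
  obtain ⟨i, hi, hne⟩ := h (Finsupp.single m 1 + d)
    (by rw [MvPolynomial.mem_support_iff, MvPolynomial.coeff_X_mul]
        exact MvPolynomial.mem_support_iff.1 hd)
  refine ⟨i, hi, ?_⟩
  have : m ≠ i := fun h => hm (h ▸ hi)
  simpa [Finsupp.single_apply, this] using hne

theorem IsGradedModule.isGradedWeaklyRegular (h : IsGradedModule S w ℳ) {ι : Type*}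
    (b : Module.Basis ι (MvPolynomial (Fin n) S) M) :
    IsGradedWeaklyRegular (MvPolynomial.X : Fin n → MvPolynomial (Fin n) S) w ℳ := by
  rintro m γ y hy ⟨c, hc⟩
  suffices hmem : y ∈ Ideal.span (MvPolynomial.X '' (Finset.Iio m : Finset (Fin n)) :
      Set (MvPolynomial (Fin n) S)) • (⊤ : Submodule (MvPolynomial (Fin n) S) M) by
    obtain ⟨e, he⟩ := exists_sum_smul_of_mem_span_smul_top _ _ hmem
    exact h.exists_homogeneous_coeff hy he
  -- Freeness reduces the question to each coordinate, that is, to the polynomial ring.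
  rw [← b.linearCombination_repr y, Finsupp.linearCombination_apply]
  refine Submodule.sum_mem _ fun i _ => Submodule.smul_mem_smul ?_ trivial
  refine MvPolynomial.mem_span_X_image_of_X_mul_mem (m := m) (by simp) ?_
  have := congrArg (fun z => b.repr z i) hc
  simp only [map_smul, Finsupp.smul_apply, smul_eq_mul, map_sum, Finsupp.finsetSum_apply] at this
  rw [this]
  exact Ideal.sum_mem _ fun k hk =>
    Ideal.mul_mem_right _ _ (Ideal.subset_span ⟨k, hk, rfl⟩)

theorem IsGradedModule.isKoszulExact (h : IsGradedModule S w ℳ) {ι : Type*}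
    (b : Module.Basis ι (MvPolynomial (Fin n) S) M) (q : ℕ) (γ : G) :
    IsKoszulExact S w ℳ (q + 1) γ :=
  fun _ hz hdz => exists_koszulD_eq_of_regular h.X_smul_mem (h.isGradedWeaklyRegular b) hz hdz

end GradedModule

/-! ### Maps of Koszul complexes -/

section KoszulMap

variable {G : Type*} [AddCommGroup G] {n : ℕ} {w : Fin n → G} {R : Type*} [CommRing R]
  {M M' : Type*} [AddCommGroup M] [Module R M] [AddCommGroup M'] [Module R M']
  {ℳ : G → AddSubgroup M} {ℳ' : G → AddSubgroup M'} {q : ℕ} {γ : G}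

theorem koszulD_compLeft (a : Fin n → R) (φ : M →ₗ[R] M') (c : Finset (Fin n) → M) :
    koszulD a M' (φ.compLeft _ c) = φ.compLeft _ (koszulD a M c) :=
  koszulD_comp a φ c

theorem compLeft_mem_koszulComponent (φ : M →ₗ[R] M') (hφ : ∀ γ, ∀ m ∈ ℳ γ, φ m ∈ ℳ' γ)
    {c : Finset (Fin n) → M} (hc : c ∈ koszulComponent w ℳ q γ) :
    φ.compLeft _ c ∈ koszulComponent w ℳ' q γ :=
  fun Q => ⟨fun h => hφ _ _ ((hc Q).1 h),
    fun h => (congrArg φ ((hc Q).2 h)).trans (map_zero φ)⟩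

theorem exists_compLeft_eq (φ : M →ₗ[R] M') {z : Finset (Fin n) → M'}
    (hz : z ∈ koszulComponent w ℳ' q γ)
    (hφ : ∀ Q : Finset (Fin n), Q.card = q → ∃ m ∈ ℳ (γ - ∑ i ∈ Q, w i), φ m = z Q) :
    ∃ y ∈ koszulComponent w ℳ q γ, φ.compLeft _ y = z := by
  have : ∀ Q : Finset (Fin n), ∃ m, φ m = z Q ∧
      (Q.card = q → m ∈ ℳ (γ - ∑ i ∈ Q, w i)) ∧ (Q.card ≠ q → m = 0) := by
    intro Q
    by_cases hQ : Q.card = q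
    · obtain ⟨m, hm, h⟩ := hφ Q hQ
      exact ⟨m, h, fun _ => hm, fun h => absurd hQ h⟩
    · exact ⟨0, by rw [map_zero, (hz Q).2 hQ], fun h => absurd h hQ, fun _ => rfl⟩
  choose y hy hy' using this
  exact ⟨y, hy', funext hy⟩

end KoszulMap

/-! ### Comparison of Tor with Koszul homology -/

namespace GradedFreeResolution

variable {G : Type*} [AddCommGroup G] {n : ℕ} {S : Type u} [CommRing S] {w : Fin n → G}
  {M : Type*} [AddCommGroup M] [Module (MvPolynomial (Fin n) S) M] {ℳ : G → AddSubgroup M}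
  (P : GradedFreeResolution.{u, v} S w ℳ) {j : ℕ} {γ : G}

local notation "∂" => koszulD (MvPolynomial.X : Fin n → MvPolynomial (Fin n) S)

theorem isKoszulExact (i q : ℕ) (γ : G) : IsKoszulExact S w (P.component i) (q + 1) γ := by
  obtain ⟨ι, b, -⟩ := P.exists_basis i
  exact (P.isGraded i).isKoszulExact b q γ

theorem exists_d_eq (i : ℕ) {q : ℕ} {z : Finset (Fin n) → P.F i}
    (hz : z ∈ koszulComponent w (P.component i) q γ) (h : ∀ Q, z Q ∈ LinearMap.range (P.d i)) :
    ∃ y ∈ koszulComponent w (P.component (i + 1)) q γ, (P.d i).compLeft _ y = z :=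
  exists_compLeft_eq _ hz fun Q hQ => (P.isGraded (i + 1)).exists_mem_map_eq (P.isGraded i) (P.d i)
    (P.d_mem i) _ _ ((hz Q).1 hQ) (h Q)

/-- Koszul exactness of `M` gives `ε y = ∂ m`; lifting `m` to `u` puts `y - ∂ u` into `ker ε = im
d`. -/
theorem exists_sub_mem_ker_ε (hM : IsGradedModule S w ℳ) (hK : IsKoszulExact S w ℳ j γ)
    {y : Finset (Fin n) → P.F 0} (hy : y ∈ koszulComponent w (P.component 0) j γ)
    (h : ∂ M (P.ε.compLeft _ y) = 0) :
    ∃ u ∈ koszulComponent w (P.component 0) (j + 1) γ,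
      ∃ v ∈ koszulComponent w (P.component 1) j γ, (P.d 0).compLeft _ v = y - ∂ (P.F 0) u := by
  obtain ⟨m, hm, hmy⟩ := hK _ (compLeft_mem_koszulComponent P.ε P.ε_mem hy) h
  obtain ⟨u, hu, rfl⟩ := exists_compLeft_eq P.ε hm fun Q hQ =>
    (P.isGraded 0).exists_mem_map_eq hM P.ε P.ε_mem _ _ ((hm Q).1 hQ) (P.ε_surjective _)
  refine ⟨u, hu, P.exists_d_eq 0
    (sub_mem hy (koszulD_mem_koszulComponent (P.isGraded 0).X_smul_mem hu)) fun Q => ?_⟩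
  rw [koszulD_compLeft] at hmy
  refine (P.exact_zero _).1 ?_
  rw [Pi.sub_apply, map_sub, sub_eq_zero]
  exact (congrFun hmy Q).symm

/-- The chase in the double complex `K_q ⊗ F_i`: it descends in `i` while `q` grows, until it
reaches `M` in Koszul degree `j`, where the hypothesis applies. -/
theorem exists_sub_mem_ker_d (hM : IsGradedModule S w ℳ) (hK : IsKoszulExact S w ℳ j γ) (i : ℕ) :
    ∀ (q : ℕ), q + i + 1 = j → ∀ y ∈ koszulComponent w (P.component (i + 1)) q γ,
      ∀ y' ∈ koszulComponent w (P.component i) (q + 1) γ,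
      (P.d i).compLeft _ y = ∂ (P.F i) y' →
      ∃ u ∈ koszulComponent w (P.component (i + 1)) (q + 1) γ,
        ∃ v ∈ koszulComponent w (P.component (i + 2)) q γ,
          (P.d (i + 1)).compLeft _ v = y - ∂ (P.F (i + 1)) u := by
  -- If `y'` can be corrected as `d v = y' - ∂ u`, then `d (y - ∂ v) = d y - ∂ y' = 0`, so `v`
  -- itself corrects `y`.
  have key : ∀ i q, ∀ y ∈ koszulComponent w (P.component (i + 1)) q γ,
      ∀ y' ∈ koszulComponent w (P.component i) (q + 1) γ,
      (P.d i).compLeft _ y = ∂ (P.F i) y' →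
      (∃ u ∈ koszulComponent w (P.component i) (q + 2) γ,
        ∃ v ∈ koszulComponent w (P.component (i + 1)) (q + 1) γ,
          (P.d i).compLeft _ v = y' - ∂ (P.F i) u) →
      ∃ u ∈ koszulComponent w (P.component (i + 1)) (q + 1) γ,
        ∃ v ∈ koszulComponent w (P.component (i + 2)) q γ,
          (P.d (i + 1)).compLeft _ v = y - ∂ (P.F (i + 1)) u := by
    rintro i q y hy y' - hyy' ⟨u, -, v, hv, hvu⟩
    refine ⟨v, hv, P.exists_d_eq (i + 1)
      (sub_mem hy (koszulD_mem_koszulComponent (P.isGraded (i + 1)).X_smul_mem hv))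
      fun Q => (P.exact_succ i _).1 ?_⟩
    have h1 := congrArg (∂ (P.F i)) hvu
    rw [map_sub, koszulD_koszulD, sub_zero, koszulD_compLeft, ← hyy'] at h1
    rw [Pi.sub_apply, map_sub, sub_eq_zero]
    exact (congrFun h1 Q).symm
  induction i with
  | zero =>
    intro q hq y hy y' hy' hyy'
    refine key 0 q y hy y' hy' hyy' (P.exists_sub_mem_ker_ε hM (by rwa [← hq] at hK) hy' ?_)
    rw [koszulD_compLeft, ← hyy']
    ext Q
    exact P.exact_zero.apply_apply_eq_zero _
  | succ i ih =>
    intro q hq y hy y' hy' hyy'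
    refine key (i + 1) q y hy y' hy' hyy' ?_
    -- As `∂ (d y') = d (d y) = 0` and the Koszul degree `q + 1` is positive, freeness of `F i`
    -- provides `y''` with `d y' = ∂ y''`.
    obtain ⟨y'', hy'', h⟩ := P.isKoszulExact i q γ ((P.d i).compLeft _ y')
      (compLeft_mem_koszulComponent _ (P.d_mem i) hy') (by
        rw [koszulD_compLeft, ← hyy']
        ext Q
        exact (P.exact_succ i).apply_apply_eq_zero _)
    exact ih (q + 1) (by omega) y' hy' y'' hy'' h.symm

theorem tmul_mk (i : ℕ) (z : P.F i) (r : MvPolynomial (Fin n) S) :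
    z ⊗ₜ[MvPolynomial (Fin n) S] (Ideal.Quotient.mk _ r : CoeffModule S n) =
      (r • z) ⊗ₜ[MvPolynomial (Fin n) S] (Ideal.Quotient.mk _ 1 : CoeffModule S n) := by
  rw [TensorProduct.smul_tmul]
  congr 1
  exact congrArg (Ideal.Quotient.mk _) (mul_one r).symm

/-- This is `F ⊗ R/(X) ≅ F/(X)F`. -/
theorem tmul_one_eq_zero_iff (i : ℕ) (z : P.F i) :
    z ⊗ₜ[MvPolynomial (Fin n) S] (Ideal.Quotient.mk _ 1 : CoeffModule S n) = 0 ↔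
      z ∈ Ideal.span (Set.range (MvPolynomial.X : Fin n → MvPolynomial (Fin n) S)) •
        (⊤ : Submodule (MvPolynomial (Fin n) S) (P.F i)) := by
  rw [← (TensorProduct.tensorQuotEquivQuotSMul (P.F i) _).map_eq_zero_iff,
    TensorProduct.tensorQuotEquivQuotSMul_tmul_mk, one_smul, Submodule.Quotient.mk_eq_zero]

theorem koszulD_tmul_one (i : ℕ) (c : Finset (Fin n) → P.F i) :
    (∂ (P.F i) c ∅) ⊗ₜ[MvPolynomial (Fin n) S] (Ideal.Quotient.mk _ 1 : CoeffModule S n) = 0 := by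
  rw [tmul_one_eq_zero_iff, koszulD_apply_empty]
  exact Submodule.sum_mem _ fun k _ =>
    Submodule.smul_mem_smul (Ideal.subset_span ⟨k, rfl⟩) trivial

theorem exists_of_mem_tensorComponent {t : P.TensorTerm j} (ht : t ∈ P.tensorComponent j γ) :
    ∃ z ∈ P.component j γ,
      t = z ⊗ₜ[MvPolynomial (Fin n) S] (Ideal.Quotient.mk _ 1 : CoeffModule S n) := by
  induction ht using AddSubgroup.closure_induction with
  | mem t ht =>
    obtain ⟨α, β, z, r, rfl, hz, hr, rfl⟩ := ht
    refine ⟨r • z, ?_, P.tmul_mk _ _ _⟩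
    rw [add_comm]
    exact (P.isGraded j).smul_mem _ _ _ _ hr hz
  | zero => exact ⟨0, zero_mem _, (TensorProduct.zero_tmul _ _).symm⟩
  | add a b _ _ ha hb =>
    obtain ⟨z, hz, rfl⟩ := ha
    obtain ⟨z', hz', rfl⟩ := hb
    exact ⟨z + z', add_mem hz hz', (TensorProduct.add_tmul _ _ _).symm⟩
  | neg a _ ha =>
    obtain ⟨z, hz, rfl⟩ := ha
    exact ⟨-z, neg_mem hz, (TensorProduct.neg_tmul _ _).symm⟩

theorem mem_range_tensorD {z : P.F j} {u : Finset (Fin n) → P.F j} {v : P.F (j + 1)}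
    (h : P.d j v = z - ∂ (P.F j) u ∅) :
    z ⊗ₜ[MvPolynomial (Fin n) S] (Ideal.Quotient.mk _ 1 : CoeffModule S n) ∈
      LinearMap.range (P.tensorD j) := by
  refine ⟨v ⊗ₜ[MvPolynomial (Fin n) S] (Ideal.Quotient.mk _ 1 : CoeffModule S n), ?_⟩
  rw [tensorD, LinearMap.rTensor_tmul, h, TensorProduct.sub_tmul, koszulD_tmul_one, sub_zero]

/-- If the Koszul homology of `M` vanishes in bidegree `(j, γ)`, so does `Tor_j(M, S)_γ`. -/
theorem torComponent_eq_bot (hM : IsGradedModule S w ℳ) (hK : IsKoszulExact S w ℳ j γ) :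
    P.torComponent j γ = ⊥ := by
  rw [eq_bot_iff]
  rintro _ ⟨⟨t, hcyc⟩, ht, rfl⟩
  obtain ⟨z, hz, rfl⟩ := P.exists_of_mem_tensorComponent ht
  rw [AddSubgroup.mem_bot]
  refine (Submodule.Quotient.mk_eq_zero _).2 ?_
  rw [Submodule.mem_comap]
  rcases j with _ | i
  · obtain ⟨u, -, v, -, h⟩ := P.exists_sub_mem_ker_ε hM hK (koszulSingle_mem (w := w) hz)
      (koszulD_eq_zero (w := w) (compLeft_mem_koszulComponent P.ε P.ε_mem (koszulSingle_mem hz)))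
    exact P.mem_range_tensorD (by simpa [koszulSingle] using congrFun h ∅)
  · have hd : P.d i z ∈ Ideal.span (Set.range (MvPolynomial.X : Fin n → MvPolynomial (Fin n) S)) •
        (⊤ : Submodule (MvPolynomial (Fin n) S) (P.F i)) := by
      rw [← tmul_one_eq_zero_iff]
      exact hcyc
    obtain ⟨c, hc⟩ := exists_sum_smul_of_mem_span_range _ hd
    obtain ⟨c, hcmem, hc⟩ := (P.isGraded i).exists_homogeneous_coeff (P.d_mem i _ _ hz) hc
    obtain ⟨u, -, v, -, h⟩ := P.exists_sub_mem_ker_d hM hK i 0 (by omega) (koszulSingle z)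
      (koszulSingle_mem hz) (∑ k, wedge (MvPolynomial (Fin n) S) k (koszulSingle (c k)))
      (sum_mem fun k _ => by
        have := wedge_mem_koszulComponent (R := MvPolynomial (Fin n) S)
          (koszulSingle_mem (w := w) (hcmem k)) k
        rwa [sub_add_cancel] at this)
      (by
        simp only [map_sum, koszulD_wedge_koszulSingle]
        rw [← koszulSingle_sum, ← hc]
        ext Q
        by_cases hQ : Q = ∅
        · subst hQ; simp [koszulSingle]
        · simp [koszulSingle, hQ])
    exact P.mem_range_tensorD (by simpa [koszulSingle] using congrFun h ∅)

end GradedFreeResolution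

/-! ### The grading of the localizations -/

section Localization

variable {R : Type*} [CommRing R] {M : Type*} [AddCommGroup M] [Module R M]

theorem LocalizedModule.exists_mk_pow {a : R} (x : LocalizedModule (Submonoid.powers a) M) :
    ∃ (k : ℕ) (m : M), x = LocalizedModule.mk m (⟨a ^ k, k, rfl⟩ : Submonoid.powers a) := by
  induction x using LocalizedModule.induction_on with
  | h m s =>
    obtain ⟨_, k, rfl⟩ := s
    exact ⟨k, m, rfl⟩

theorem LocalizedModule.pow_smul_mk_pow (a : R) (k l : ℕ) (m : M) :
    a ^ l • LocalizedModule.mk m (⟨a ^ (l + k), l + k, rfl⟩ : Submonoid.powers a) =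
      LocalizedModule.mk m (⟨a ^ k, k, rfl⟩ : Submonoid.powers a) := by
  rw [LocalizedModule.smul'_mk, LocalizedModule.mk_eq]
  refine ⟨1, ?_⟩
  simp only [one_smul, Submonoid.smul_def, smul_smul]
  rw [← pow_add, add_comm]

/-- A divisor of `b` acts invertibly on `M_b`, so denominators can be cleared. -/
theorem eq_of_pow_smul_eq {a b : R} (h : a ∣ b) (k : ℕ)
    {x y : LocalizedModule (Submonoid.powers b) M} (hxy : a ^ k • x = a ^ k • y) : x = y := by
  have := isUnit_algebraMap_end_of_dvd (M := M) h ⟨a ^ k, k, rfl⟩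
  exact ((Module.End.isUnit_iff _).1 this).1 hxy

theorem localizationMap_mk_one {a b : R} (h : a ∣ b) (m : M) :
    localizationMap M a b h (LocalizedModule.mk m 1) = LocalizedModule.mk m 1 :=
  LocalizedModule.lift_mk_one _ _ _ _

theorem localizationMap_mk {a b c : R} (h : a ∣ b) (hb : a * c = b) (k : ℕ) (m : M) :
    localizationMap M a b h (LocalizedModule.mk m (⟨a ^ k, k, rfl⟩ : Submonoid.powers a)) =
      LocalizedModule.mk (c ^ k • m) (⟨b ^ k, k, rfl⟩ : Submonoid.powers b) := by
  refine eq_of_pow_smul_eq h k ?_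
  rw [← map_smul]
  have h1 := LocalizedModule.pow_smul_mk_pow a 0 k m
  have h2 := LocalizedModule.pow_smul_mk_pow b 0 k m
  simp only [pow_zero, add_zero] at h1 h2
  rw [h1, LocalizedModule.smul'_mk, smul_smul, ← mul_pow, hb, ← LocalizedModule.smul'_mk, h2]
  exact localizationMap_mk_one h m

theorem localizationMap_localizationMap {a b c : R} (hab : a ∣ b) (hbc : b ∣ c)
    (x : LocalizedModule (Submonoid.powers a) M) :
    localizationMap M b c hbc (localizationMap M a b hab x) =
      localizationMap M a c (hab.trans hbc) x := by
  obtain ⟨e, rfl⟩ := hab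
  obtain ⟨e', rfl⟩ := hbc
  obtain ⟨k, m, rfl⟩ := x.exists_mk_pow
  rw [localizationMap_mk _ rfl, localizationMap_mk _ rfl, localizationMap_mk _ (mul_assoc a e e').symm,
    smul_smul, ← mul_pow, mul_comm e' e]

end Localization

section LocalizationDegree

variable {G : Type*} [AddCommGroup G] {n : ℕ} {S : Type*} [CommRing S] {w : Fin n → G}
  {M : Type*} [AddCommGroup M] [Module (MvPolynomial (Fin n) S) M] {ℳ : G → AddSubgroup M}
  {a b c : MvPolynomial (Fin n) S} {δ δ' : G}

theorem IsGradedModule.proj_pow_smul (h : IsGradedModule S w ℳ)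
    (ha : MvPolynomial.IsWeightedHomogeneous w a δ) (t : ℕ) (γ : G) (m : M) :
    a ^ t • h.proj γ m = h.proj (γ + t • δ) (a ^ t • m) := by
  rw [add_comm, h.proj_smul (ha.pow t)]

/-- Both sides are the part of degree `γ + (t + k + k') δ` of one element. The exponents are
arbitrary because a power of `a` need not determine its exponent; this makes the projection of `M_a`
well defined. -/
theorem IsGradedModule.smul_proj_eq (h : IsGradedModule S w ℳ)
    (ha : MvPolynomial.IsWeightedHomogeneous w a δ) {t k k' : ℕ} {m m' : M}
    (hm : a ^ t • a ^ k' • m = a ^ t • a ^ k • m') (γ : G) :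
    a ^ t • a ^ k' • h.proj (γ + k • δ) m = a ^ t • a ^ k • h.proj (γ + k' • δ) m' := by
  rw [h.proj_pow_smul ha, h.proj_pow_smul ha, h.proj_pow_smul ha, h.proj_pow_smul ha, hm,
    add_right_comm γ]

/-- The projection of the localization `M_a` onto its component of degree `γ`, as a function. -/
def IsGradedModule.localizedProjFun (h : IsGradedModule S w ℳ)
    (ha : MvPolynomial.IsWeightedHomogeneous w a δ) (γ : G)
    (x : LocalizedModule (Submonoid.powers a) M) : LocalizedModule (Submonoid.powers a) M :=
  x.liftOn (fun p => LocalizedModule.mk (h.proj (γ + p.2.2.choose • δ) p.1) p.2) (by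
    rintro ⟨m, s⟩ ⟨m', s'⟩ ⟨u, hu⟩
    refine LocalizedModule.mk_eq.2 ⟨u, ?_⟩
    have hs : a ^ s.2.choose = s := s.2.choose_spec
    have hs' : a ^ s'.2.choose = s' := s'.2.choose_spec
    have hu' : a ^ u.2.choose = u := u.2.choose_spec
    simp only [Submonoid.smul_def] at hu ⊢
    have := h.smul_proj_eq ha (t := u.2.choose) (k := s.2.choose) (k' := s'.2.choose) (m := m)
      (m' := m') (by rwa [hs, hs', hu']) γ
    rwa [hs, hs', hu'] at this)

theorem IsGradedModule.localizedProjFun_mk (h : IsGradedModule S w ℳ)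
    (ha : MvPolynomial.IsWeightedHomogeneous w a δ) (γ : G) (k : ℕ) (m : M) :
    h.localizedProjFun ha γ (LocalizedModule.mk m (⟨a ^ k, k, rfl⟩ : Submonoid.powers a)) =
      LocalizedModule.mk (h.proj (γ + k • δ) m) (⟨a ^ k, k, rfl⟩ : Submonoid.powers a) := by
  set s : Submonoid.powers a := ⟨a ^ k, k, rfl⟩ with hs
  have hk : a ^ s.2.choose = a ^ k := s.2.choose_spec
  refine (LocalizedModule.liftOn_mk _ _ _).trans (LocalizedModule.mk_eq.2 ⟨1, ?_⟩)
  have := h.smul_proj_eq ha (t := 0) (k := s.2.choose) (k' := k) (m := m) (m' := m)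
    (by rw [hk]) γ
  rw [pow_zero, one_smul, one_smul, hk] at this
  rw [one_smul, one_smul]
  exact this

/-- The projection of the localization `M_a` onto its component of degree `γ`. -/
def IsGradedModule.localizedProj (h : IsGradedModule S w ℳ)
    (ha : MvPolynomial.IsWeightedHomogeneous w a δ) (γ : G) :
    LocalizedModule (Submonoid.powers a) M →+ LocalizedModule (Submonoid.powers a) M :=
  AddMonoidHom.mk' (h.localizedProjFun ha γ) (by
    intro x y
    obtain ⟨k, m, rfl⟩ := x.exists_mk_pow
    obtain ⟨l, m', rfl⟩ := y.exists_mk_pow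
    have hmul : (⟨a ^ k, k, rfl⟩ : Submonoid.powers a) * ⟨a ^ l, l, rfl⟩ =
        ⟨a ^ (k + l), k + l, rfl⟩ := Subtype.ext (pow_add a k l).symm
    rw [LocalizedModule.mk_add_mk, hmul, h.localizedProjFun_mk, h.localizedProjFun_mk,
      h.localizedProjFun_mk, LocalizedModule.mk_add_mk, hmul]
    congr 1
    simp only [Submonoid.smul_def]
    rw [map_add, h.proj_pow_smul ha, h.proj_pow_smul ha, add_assoc, add_assoc, ← add_smul,
      ← add_smul, add_comm l k])

theorem IsGradedModule.localizedProj_mk (h : IsGradedModule S w ℳ)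
    (ha : MvPolynomial.IsWeightedHomogeneous w a δ) (γ : G) (k : ℕ) (m : M) :
    h.localizedProj ha γ (LocalizedModule.mk m (⟨a ^ k, k, rfl⟩ : Submonoid.powers a)) =
      LocalizedModule.mk (h.proj (γ + k • δ) m) (⟨a ^ k, k, rfl⟩ : Submonoid.powers a) :=
  h.localizedProjFun_mk ha γ k m

theorem mk_mem_localizedComponent {γ : G} {k : ℕ} {m : M} (hm : m ∈ ℳ (γ + k • δ)) :
    LocalizedModule.mk m (⟨a ^ k, k, rfl⟩ : Submonoid.powers a) ∈
      localizedComponent ℳ a δ γ :=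
  AddSubgroup.subset_closure ⟨k, m, hm, rfl⟩

theorem IsGradedModule.localizedProj_mem (h : IsGradedModule S w ℳ)
    (ha : MvPolynomial.IsWeightedHomogeneous w a δ) (γ : G)
    (x : LocalizedModule (Submonoid.powers a) M) :
    h.localizedProj ha γ x ∈ localizedComponent ℳ a δ γ := by
  obtain ⟨k, m, rfl⟩ := x.exists_mk_pow
  rw [h.localizedProj_mk]
  exact mk_mem_localizedComponent (h.proj_mem _ _)

theorem IsGradedModule.localizedProj_same (h : IsGradedModule S w ℳ)
    (ha : MvPolynomial.IsWeightedHomogeneous w a δ) {γ : G}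
    {x : LocalizedModule (Submonoid.powers a) M} (hx : x ∈ localizedComponent ℳ a δ γ) :
    h.localizedProj ha γ x = x := by
  induction hx using AddSubgroup.closure_induction with
  | mem x hx =>
    obtain ⟨k, m, hm, rfl⟩ := hx
    rw [h.localizedProj_mk, h.proj_same hm]
  | zero => exact map_zero _
  | add x y _ _ hx hy => rw [map_add, hx, hy]
  | neg x _ hx => rw [map_neg, hx]

/-- The component is defined as a generated subgroup; applying the projection to an arbitrary
representative shows that one homogeneous fraction suffices. -/
theorem IsGradedModule.exists_mk_of_mem (h : IsGradedModule S w ℳ)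
    (ha : MvPolynomial.IsWeightedHomogeneous w a δ) {γ : G}
    {x : LocalizedModule (Submonoid.powers a) M} (hx : x ∈ localizedComponent ℳ a δ γ) :
    ∃ (k : ℕ) (m : M), m ∈ ℳ (γ + k • δ) ∧
      x = LocalizedModule.mk m (⟨a ^ k, k, rfl⟩ : Submonoid.powers a) := by
  obtain ⟨k, m, hm⟩ := x.exists_mk_pow
  refine ⟨k, h.proj (γ + k • δ) m, h.proj_mem _ _, ?_⟩
  rw [← h.localizedProj_mk ha, ← hm, h.localizedProj_same ha hx]

theorem IsGradedModule.localizedProj_localizationMap (h : IsGradedModule S w ℳ)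
    (ha : MvPolynomial.IsWeightedHomogeneous w a δ) (hc : MvPolynomial.IsWeightedHomogeneous w c δ')
    {ε : G} (hb : MvPolynomial.IsWeightedHomogeneous w b ε)
    (hab : a ∣ b) (habc : a * c = b) (hε : δ + δ' = ε) (γ : G)
    (x : LocalizedModule (Submonoid.powers a) M) :
    h.localizedProj hb γ (localizationMap M a b hab x) =
      localizationMap M a b hab (h.localizedProj ha γ x) := by
  obtain ⟨k, m, rfl⟩ := x.exists_mk_pow
  rw [h.localizedProj_mk, localizationMap_mk hab habc, localizationMap_mk hab habc,
    h.localizedProj_mk, h.proj_pow_smul hc, ← hε, smul_add, add_assoc]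

theorem IsGradedModule.smul_mem_localizedComponent (h : IsGradedModule S w ℳ)
    (ha : MvPolynomial.IsWeightedHomogeneous w a δ) {α : G} {r : MvPolynomial (Fin n) S}
    (hr : MvPolynomial.IsWeightedHomogeneous w r α) {γ : G}
    {x : LocalizedModule (Submonoid.powers a) M} (hx : x ∈ localizedComponent ℳ a δ γ) :
    r • x ∈ localizedComponent ℳ a δ (α + γ) := by
  obtain ⟨k, m, hm, rfl⟩ := h.exists_mk_of_mem ha hx
  rw [LocalizedModule.smul'_mk]
  refine mk_mem_localizedComponent ?_
  rw [add_assoc]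
  exact h.smul_mem _ _ _ _ hr hm

/-- Inverting a homogeneous element of the ideal of the variables makes the Koszul complex exact. -/
theorem IsGradedModule.isKoszulExact_localized (h : IsGradedModule S w ℳ)
    (ha : MvPolynomial.IsWeightedHomogeneous w a δ)
    (haX : a ∈ Ideal.span (Set.range (MvPolynomial.X : Fin n → MvPolynomial (Fin n) S)))
    (q : ℕ) (γ : G) : IsKoszulExact S w (localizedComponent ℳ a δ) q γ := by
  obtain ⟨e, he⟩ := exists_sum_smul_of_mem_span_range (N := MvPolynomial (Fin n) S)
    (MvPolynomial.X : Fin n → MvPolynomial (Fin n) S) (y := a)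
    (by rwa [smul_eq_mul, Ideal.mul_top])
  obtain ⟨e, hemem, he⟩ := (isGradedModule_mvPolynomial S w).exists_homogeneous_coeff
    (γ := δ) (y := a) ha he
  have hsum : ∑ k, e k * MvPolynomial.X k = a := by
    rw [he]; exact Finset.sum_congr rfl fun k _ => mul_comm _ _
  intro z hz hdz
  -- Here `a = ∑ e_k X_k` with `e_k` of degree `δ - w k`, and `a` acts bijectively on `M_a`,
  -- shifting degrees by `δ`.
  refine exists_koszulD_eq_of_homotopy (e := e) (δ := δ)
    (fun k β m hm => h.smul_mem_localizedComponent ha (hemem k) hm) (fun β m hm => ?_)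
    (fun m hm => ?_) hz hdz
  · rw [hsum]
    obtain ⟨k, m, hm, rfl⟩ := h.exists_mk_of_mem ha hm
    refine ⟨LocalizedModule.mk m (⟨a ^ (1 + k), 1 + k, rfl⟩ : Submonoid.powers a),
      mk_mem_localizedComponent ?_, ?_⟩
    · rwa [add_smul, one_smul, ← add_assoc, sub_add_cancel]
    · simpa using LocalizedModule.pow_smul_mk_pow a k 1 m
  · rw [hsum] at hm
    exact eq_of_pow_smul_eq dvd_rfl 1 (by rw [pow_one, hm, smul_zero])

end LocalizationDegree

/-! ### The Čech complex -/

section CechSquare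

variable {R : Type*} [CommRing R] {M : Type*} [AddCommGroup M] [Module R M] {s p : ℕ}
  {f : Fin s → R}

theorem cechDifferential_apply (c : CechCochain f M p) (J : {J : Finset (Fin s) // J.card = p + 1}) :
    cechDifferential f M p c J = ∑ k : {k // k ∈ J.1}, positionSign R k.1 J.1 •
      localizationMap M _ _ (prod_eraseIndex_dvd f J k) (c (eraseIndex J k)) := by
  simp [cechDifferential, positionSign]

theorem Finset.sum_univ_subtype_eq_sum_dite {ι A : Type*} [Fintype ι] [DecidableEq ι]
    [AddCommMonoid A] (t : Finset ι) (F : {k // k ∈ t} → A) :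
    ∑ k, F k = ∑ k, if h : k ∈ t then F ⟨k, h⟩ else 0 := by
  have h1 : ∀ k : {k // k ∈ t}, F k = (fun k => if h : k ∈ t then F ⟨k, h⟩ else 0) k.1 :=
    fun k => by simp [k.2]
  rw [Finset.sum_congr rfl fun k _ => h1 k,
    Finset.sum_coe_sort t (fun k => if h : k ∈ t then F ⟨k, h⟩ else 0)]
  exact Finset.sum_subset (Finset.subset_univ _) fun k _ hk => by simp [hk]

/-- The value of a Čech cochain at `I`, seen in the localization at `L`; zero if it is not
defined. -/
def restrictedValue (c : CechCochain f M p) (L I : Finset (Fin s)) :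
    LocalizedModule (Submonoid.powers (∏ i ∈ L, f i)) M :=
  if h : I.card = p ∧ I ⊆ L then
    localizationMap M _ _ (Finset.prod_dvd_prod_of_subset _ _ f h.2) (c ⟨I, h.1⟩) else 0

/-- Moving every value into the single module at `L` removes the dependence on the subset, so that
the terms of `d ∘ d` can be compared and cancelled in pairs. -/
theorem localizationMap_cechDifferential (c : CechCochain f M p) {L : Finset (Fin s)}
    (J : {J : Finset (Fin s) // J.card = p + 1}) (hJ : J.1 ⊆ L) :
    localizationMap M _ _ (Finset.prod_dvd_prod_of_subset _ _ f hJ) (cechDifferential f M p c J) =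
      ∑ l, if l ∈ J.1 then positionSign R l J.1 • restrictedValue c L (J.1.erase l) else 0 := by
  rw [cechDifferential_apply, map_sum, Finset.sum_univ_subtype_eq_sum_dite]
  refine Finset.sum_congr rfl fun l _ => ?_
  by_cases hl : l ∈ J.1
  · rw [dif_pos hl, if_pos hl, map_smul, localizationMap_localizationMap, restrictedValue, dif_pos]
    · rfl
    · exact ⟨by rw [Finset.card_erase_of_mem hl, J.2]; rfl, (Finset.erase_subset _ _).trans hJ⟩
  · rw [dif_neg hl, if_neg hl]

theorem positionSign_mul_erase {L : Finset (Fin s)} {k l : Fin s} (hk : k ∈ L) (hl : l ∈ L)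
    (hkl : k ≠ l) :
    positionSign R k L * positionSign R l (L.erase k) =
      -(positionSign R l L * positionSign R k (L.erase l)) := by
  obtain ⟨T, hkT, rfl⟩ : ∃ T, k ∉ T ∧ insert k T = L :=
    ⟨L.erase k, Finset.notMem_erase _ _, Finset.insert_erase hk⟩
  obtain ⟨T, hlT, rfl⟩ : ∃ U, l ∉ U ∧ insert l U = T :=
    ⟨T.erase l, Finset.notMem_erase _ _,
      Finset.insert_erase (Finset.mem_of_mem_insert_of_ne hl hkl.symm)⟩
  have hkT' : k ∉ T := fun h => hkT (Finset.mem_insert_of_mem h)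
  have hlkT : l ∉ insert k T := by simp [hlT, hkl.symm]
  rw [Finset.erase_insert hkT, Finset.insert_comm, Finset.erase_insert hlkT,
    positionSign_insert hlkT, positionSign_insert hlkT, positionSign_insert hlT,
    positionSign_insert hkT', positionSign_insert hkT', if_neg (lt_irrefl _), if_neg (lt_irrefl _)]
  rcases lt_or_gt_of_ne hkl with h | h
  · simp [h, h.not_gt, mul_comm]
  · simp [h, h.not_gt, mul_comm]

theorem cechDifferential_cechDifferential (c : CechCochain f M p) :
    cechDifferential f M (p + 1) (cechDifferential f M p c) = 0 := by
  ext1 L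
  rw [cechDifferential_apply, Finset.sum_univ_subtype_eq_sum_dite]
  have key : ∀ k : Fin s, (if h : k ∈ L.1 then positionSign R k L.1 •
      localizationMap M _ _ (prod_eraseIndex_dvd f L ⟨k, h⟩)
        (cechDifferential f M p c (eraseIndex L ⟨k, h⟩)) else 0) =
      ∑ l, if k ∈ L.1 ∧ l ∈ L.1 ∧ l ≠ k then
        (positionSign R k L.1 * positionSign R l (L.1.erase k)) •
          restrictedValue c L.1 ((L.1.erase k).erase l) else 0 := by
    intro k
    by_cases hk : k ∈ L.1
    · rw [dif_pos hk, localizationMap_cechDifferential c (eraseIndex L ⟨k, hk⟩)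
        (Finset.erase_subset _ _), Finset.smul_sum]
      refine Finset.sum_congr rfl fun l _ => ?_
      by_cases hl : l ∈ L.1 ∧ l ≠ k
      · rw [if_pos (by simp [eraseIndex, hl]), if_pos ⟨hk, hl⟩, smul_smul]; rfl
      · rw [if_neg (by simpa [eraseIndex, and_comm] using hl), if_neg (fun h => hl h.2), smul_zero]
    · simp [hk]
  rw [Finset.sum_congr rfl fun k _ => key k, Pi.zero_apply]
  refine Finset.sum_sum_eq_zero_of_alternating _ (fun k => by simp) fun k l hkl => ?_
  by_cases h : k ∈ L.1 ∧ l ∈ L.1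
  · rw [if_pos ⟨h.1, h.2, hkl.symm⟩, if_pos ⟨h.2, h.1, hkl⟩, positionSign_mul_erase h.1 h.2 hkl,
      Finset.erase_right_comm, neg_smul, neg_add_cancel]
  · rw [if_neg (fun h' => h ⟨h'.1, h'.2.1⟩), if_neg (fun h' => h ⟨h'.2.1, h'.1⟩), add_zero]

end CechSquare

section CechDegree

variable {G : Type*} [AddCommGroup G] {n s : ℕ} {S : Type*} [CommRing S] {w : Fin n → G}
  {f : Fin s → MvPolynomial (Fin n) S} {d : Fin s → G}
  {M : Type*} [AddCommGroup M] [Module (MvPolynomial (Fin n) S) M] {ℳ : G → AddSubgroup M}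
  {p : ℕ} {γ : G}

local notation "∂" => koszulD (MvPolynomial.X : Fin n → MvPolynomial (Fin n) S)

theorem mem_cechComponent {c : CechCochain f M p} : c ∈ cechComponent f d ℳ p γ ↔
    ∀ I, c I ∈ localizedComponent ℳ (∏ i ∈ I.1, f i) (∑ i ∈ I.1, d i) γ := by
  simp [cechComponent, AddSubgroup.mem_pi]

theorem isWeightedHomogeneous_prod (hf : ∀ i, MvPolynomial.IsWeightedHomogeneous w (f i) (d i))
    (I : Finset (Fin s)) :
    MvPolynomial.IsWeightedHomogeneous w (∏ i ∈ I, f i) (∑ i ∈ I, d i) :=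
  MvPolynomial.IsWeightedHomogeneous.prod I f d fun i _ => hf i

/-- The projection of the Čech cochains onto the component of degree `γ`. -/
def IsGradedModule.cechProj (h : IsGradedModule S w ℳ)
    (hf : ∀ i, MvPolynomial.IsWeightedHomogeneous w (f i) (d i)) (p : ℕ) (γ : G)
    (c : CechCochain f M p) : CechCochain f M p :=
  fun I => h.localizedProj (isWeightedHomogeneous_prod hf I.1) γ (c I)

theorem IsGradedModule.cechProj_mem (h : IsGradedModule S w ℳ)
    (hf : ∀ i, MvPolynomial.IsWeightedHomogeneous w (f i) (d i)) (p : ℕ) (γ : G)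
    (c : CechCochain f M p) : h.cechProj hf p γ c ∈ cechComponent f d ℳ p γ :=
  mem_cechComponent.2 fun _ => h.localizedProj_mem _ _ _

theorem IsGradedModule.cechProj_same (h : IsGradedModule S w ℳ)
    (hf : ∀ i, MvPolynomial.IsWeightedHomogeneous w (f i) (d i))
    {c : CechCochain f M p} (hc : c ∈ cechComponent f d ℳ p γ) : h.cechProj hf p γ c = c :=
  funext fun I => h.localizedProj_same _ (mem_cechComponent.1 hc I)

theorem map_positionSign_smul {A : Type*} [AddCommGroup A] [Module (MvPolynomial (Fin n) S) A]
    (φ : A →+ A) (k : Fin s) (Q : Finset (Fin s)) (m : A) :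
    φ (positionSign (MvPolynomial (Fin n) S) k Q • m) =
      positionSign (MvPolynomial (Fin n) S) k Q • φ m := by
  unfold positionSign
  rcases neg_one_pow_eq_or (MvPolynomial (Fin n) S) (Q.filter (· < k)).card with h | h
  · rw [h, one_smul, one_smul]
  · rw [h, neg_smul, one_smul, neg_smul, one_smul, map_neg]

theorem IsGradedModule.cechDifferential_cechProj (h : IsGradedModule S w ℳ)
    (hf : ∀ i, MvPolynomial.IsWeightedHomogeneous w (f i) (d i)) (p : ℕ) (γ : G)
    (c : CechCochain f M p) :
    cechDifferential f M p (h.cechProj hf p γ c) =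
      h.cechProj hf (p + 1) γ (cechDifferential f M p c) := by
  ext1 J
  rw [cechProj, cechDifferential_apply, cechDifferential_apply, map_sum]
  refine Finset.sum_congr rfl fun k _ => ?_
  rw [map_positionSign_smul]
  congr 1
  symm
  exact h.localizedProj_localizationMap _ (hf k) _ _
    (Finset.prod_erase_mul J.1 f k.2) (Finset.sum_erase_add J.1 d k.2) _ _

theorem IsGradedModule.cechDifferential_mem (h : IsGradedModule S w ℳ)
    (hf : ∀ i, MvPolynomial.IsWeightedHomogeneous w (f i) (d i)) (γ : G)
    (c : CechCochain f M p) (hc : c ∈ cechComponent f d ℳ p γ) :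
    cechDifferential f M p c ∈ cechComponent f d ℳ (p + 1) γ := by
  rw [← h.cechProj_same hf hc, h.cechDifferential_cechProj]
  exact h.cechProj_mem hf _ _ _

theorem mem_cechCoboundaries_of_cohomologyComponent_eq_bot
    (hH : cohomologyComponent f d ℳ p γ = ⊥) {c : CechCochain f M p}
    (hc : c ∈ cechComponent f d ℳ p γ) (hdc : cechDifferential f M p c = 0) :
    c ∈ cechCoboundaries f M p := by
  have : Submodule.mkQ ((cechCoboundaries f M p).comap
      (LinearMap.ker (cechDifferential f M p)).subtype) ⟨c, hdc⟩ ∈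
        cohomologyComponent f d ℳ p γ := ⟨⟨c, hdc⟩, hc, rfl⟩
  rw [hH, AddSubgroup.mem_bot] at this
  exact (Submodule.Quotient.mk_eq_zero ((cechCoboundaries f M p).comap
    (LinearMap.ker (cechDifferential f M p)).subtype)).1 this

/-- Vanishing of the component yields some cochain; its projection to degree `γ` has the same
boundary. -/
theorem IsGradedModule.exists_cechDifferential_eq (h : IsGradedModule S w ℳ)
    (hf : ∀ i, MvPolynomial.IsWeightedHomogeneous w (f i) (d i))
    (hH : cohomologyComponent f d ℳ (p + 1) γ = ⊥) {c : CechCochain f M (p + 1)}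
    (hc : c ∈ cechComponent f d ℳ (p + 1) γ) (hdc : cechDifferential f M (p + 1) c = 0) :
    ∃ v ∈ cechComponent f d ℳ p γ, cechDifferential f M p v = c := by
  obtain ⟨v, hv⟩ := mem_cechCoboundaries_of_cohomologyComponent_eq_bot hH hc hdc
  refine ⟨h.cechProj hf p γ v, h.cechProj_mem hf _ _ _, ?_⟩
  rw [h.cechDifferential_cechProj, hv, h.cechProj_same hf hc]

theorem IsGradedModule.isKoszulExact_cech (h : IsGradedModule S w ℳ)
    (hf : ∀ i, MvPolynomial.IsWeightedHomogeneous w (f i) (d i))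
    (hfX : ∀ i, f i ∈ Ideal.span
      (Set.range (MvPolynomial.X : Fin n → MvPolynomial (Fin n) S))) (p q : ℕ) (γ : G) :
    IsKoszulExact S w (cechComponent f d ℳ (p + 1)) q γ := by
  intro z hz hdz
  have hex : ∀ I : {I : Finset (Fin s) // I.card = p + 1},
      ∃ y ∈ koszulComponent w (localizedComponent ℳ (∏ i ∈ I.1, f i) (∑ i ∈ I.1, d i)) (q + 1) γ,
        ∂ _ y = fun Q => z Q I := by
    intro I
    -- In positive Čech degree some `f i` divides the inverted product, which therefore lies in
    -- `(X₁, …, Xₙ)`.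
    obtain ⟨i, hi⟩ : I.1.Nonempty := Finset.card_pos.1 (by rw [I.2]; exact Nat.succ_pos _)
    refine h.isKoszulExact_localized (isWeightedHomogeneous_prod hf I.1)
      (Ideal.mem_of_dvd _ (Finset.dvd_prod_of_mem f hi) (hfX i)) q γ _ ?_ ?_
    · exact compLeft_mem_koszulComponent (LinearMap.proj (R := MvPolynomial (Fin n) S) I)
        (fun γ m hm => mem_cechComponent.1 hm I) hz
    · refine (koszulD_compLeft _ (LinearMap.proj (R := MvPolynomial (Fin n) S) I) z).trans ?_
      rw [hdz, map_zero]
  choose y hy hyz using hex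
  refine ⟨fun Q I => y I Q, fun Q => ⟨fun hQ => mem_cechComponent.2 fun I => (hy I Q).1 hQ,
    fun hQ => funext fun I => (hy I Q).2 hQ⟩, ?_⟩
  ext1 Q
  ext1 I
  have := koszulD_compLeft (MvPolynomial.X : Fin n → MvPolynomial (Fin n) S) (LinearMap.proj (R := MvPolynomial (Fin n) S) I)
    (fun (Q : Finset (Fin n)) I => y I Q : Finset (Fin n) → CechCochain f M (p + 1))
  exact (congrFun this Q).symm.trans (congrFun (hyz I) Q)

/-- Descending induction on the Čech degree `p`, along the diagonal `q = p + j`, with `m` bounding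
the distance to the end `s` of the complex. -/
theorem IsGradedModule.exists_cechDifferential_sub_eq_zero (h : IsGradedModule S w ℳ)
    (hf : ∀ i, MvPolynomial.IsWeightedHomogeneous w (f i) (d i))
    (hfX : ∀ i, f i ∈ Ideal.span
      (Set.range (MvPolynomial.X : Fin n → MvPolynomial (Fin n) S))) {j : ℕ}
    (hH : ∀ (p : ℕ) (Q : Finset (Fin n)), Q.card = p + j →
      cohomologyComponent f d ℳ p (γ - ∑ i ∈ Q, w i) = ⊥) (m : ℕ) :
    ∀ p q, s ≤ p + m → q = p + j → ∀ y ∈ koszulComponent w (cechComponent f d ℳ p) q γ,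
      ∂ _ ((cechDifferential f M p).compLeft _ y) = 0 →
      ∃ u ∈ koszulComponent w (cechComponent f d ℳ p) (q + 1) γ,
        (cechDifferential f M p).compLeft _ (y - ∂ _ u) = 0 := by
  induction m with
  | zero =>
    intro p q hp hq y hy _
    refine ⟨0, zero_mem _, ?_⟩
    ext Q J
    -- For `p ≥ s` there are no subsets with `p + 1` elements, so the target is zero.
    exact absurd (Finset.card_le_univ J.1) (by rw [J.2, Fintype.card_fin]; omega)
  | succ m ih =>
    intro p q hp hq y hy hdy
    have hdd : ∀ z : Finset (Fin n) → CechCochain f M p, (cechDifferential f M (p + 1)).compLeft _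
        ((cechDifferential f M p).compLeft _ z) = 0 := fun z => by
      ext1 Q; exact cechDifferential_cechDifferential (z Q)
    have hXC : ∀ k β, ∀ c ∈ cechComponent f d ℳ (p + 1) β,
        (MvPolynomial.X k : MvPolynomial (Fin n) S) • c ∈
          cechComponent f d ℳ (p + 1) (w k + β) := fun k β c hc =>
      mem_cechComponent.2 fun I => h.smul_mem_localizedComponent (isWeightedHomogeneous_prod hf I.1)
        (MvPolynomial.isWeightedHomogeneous_X S w k) (mem_cechComponent.1 hc I)
    -- With `δ` the Čech differential: Koszul exactness gives `δ y = ∂ y'`, induction gives `δ (y' -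
    -- ∂ u') = 0`, and vanishing of `H^{p+1}` gives `y' - ∂ u' = δ v`. Hence `δ (∂ v) = ∂ y' = δ y`.
    obtain ⟨y', hy', hyy'⟩ := h.isKoszulExact_cech hf hfX p q γ _
      (compLeft_mem_koszulComponent _ (h.cechDifferential_mem hf) hy) hdy
    obtain ⟨u', hu', hu'd⟩ := ih (p + 1) (q + 1) (by omega) (by omega) y' hy' (by
      rw [koszulD_compLeft, hyy', hdd])
    obtain ⟨v, hv, hvd⟩ := exists_compLeft_eq (ℳ := cechComponent f d ℳ p)
      (cechDifferential f M p) (sub_mem hy' (koszulD_mem_koszulComponent hXC hu')) fun Q hQ =>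
        h.exists_cechDifferential_eq hf (hH (p + 1) Q (by omega))
          ((sub_mem hy' (koszulD_mem_koszulComponent hXC hu') Q).1 hQ) (congrFun hu'd Q)
    refine ⟨v, hv, ?_⟩
    rw [map_sub, ← hyy', ← koszulD_compLeft, hvd, map_sub, koszulD_koszulD, sub_zero, sub_self]

/-- The identification of `M` with the Čech cochains of degree `0`. -/
def toCechZero (f : Fin s → MvPolynomial (Fin n) S) (M : Type*) [AddCommGroup M]
    [Module (MvPolynomial (Fin n) S) M] : M →ₗ[MvPolynomial (Fin n) S] CechCochain f M 0 :=
  LinearMap.pi fun I => LocalizedModule.mkLinearMap (Submonoid.powers (∏ i ∈ I.1, f i)) M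

theorem toCechZero_injective : Function.Injective (toCechZero f M) := by
  intro m m' hm
  obtain ⟨⟨_, k, rfl⟩, hu⟩ := LocalizedModule.mk_eq.1 (congrFun hm ⟨∅, rfl⟩)
  have hu' : (∏ i ∈ (∅ : Finset (Fin s)), f i) ^ k • (1 : MvPolynomial (Fin n) S) • m =
      (∏ i ∈ (∅ : Finset (Fin s)), f i) ^ k • (1 : MvPolynomial (Fin n) S) • m' := hu
  simpa using hu'

theorem toCechZero_mem (γ : G) (m : M) (hm : m ∈ ℳ γ) :
    toCechZero f M m ∈ cechComponent f d ℳ 0 γ := by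
  refine mem_cechComponent.2 fun I => AddSubgroup.subset_closure ⟨0, m, by simpa using hm, ?_⟩
  simp only [pow_zero]
  rfl

theorem IsGradedModule.exists_toCechZero_eq (h : IsGradedModule S w ℳ)
    (hf : ∀ i, MvPolynomial.IsWeightedHomogeneous w (f i) (d i))
    {c : CechCochain f M 0} (hc : c ∈ cechComponent f d ℳ 0 γ) :
    ∃ m ∈ ℳ γ, toCechZero f M m = c := by
  obtain ⟨k, m, hm, hcm⟩ := h.exists_mk_of_mem (isWeightedHomogeneous_prod hf ∅)
    (mem_cechComponent.1 hc ⟨∅, rfl⟩)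
  refine ⟨m, by simpa using hm, ?_⟩
  ext1 ⟨I, hI⟩
  obtain rfl := Finset.card_eq_zero.1 hI
  rw [hcm]
  refine LocalizedModule.mk_eq.2 ⟨1, ?_⟩
  change (1 : MvPolynomial (Fin n) S) • (∏ i ∈ (∅ : Finset (Fin s)), f i) ^ k • m =
    (1 : MvPolynomial (Fin n) S) • (1 : MvPolynomial (Fin n) S) • m
  simp

/-- If `H^p_B(M)_{γ - γ_Q} = 0` for all `p` and all `Q` of cardinality `p + j`, the Koszul homology
of `M` vanishes in bidegree `(j, γ)`. -/
theorem IsGradedModule.isKoszulExact_of_cohomologyComponent_eq_bot (h : IsGradedModule S w ℳ)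
    (hf : ∀ i, MvPolynomial.IsWeightedHomogeneous w (f i) (d i))
    (hfX : ∀ i, f i ∈ Ideal.span
      (Set.range (MvPolynomial.X : Fin n → MvPolynomial (Fin n) S))) {j : ℕ}
    (hH : ∀ (p : ℕ) (Q : Finset (Fin n)), Q.card = p + j →
      cohomologyComponent f d ℳ p (γ - ∑ i ∈ Q, w i) = ⊥) :
    IsKoszulExact S w ℳ j γ := by
  intro z hz hdz
  have hXC : ∀ k β, ∀ c ∈ cechComponent f d ℳ 0 β,
      (MvPolynomial.X k : MvPolynomial (Fin n) S) • c ∈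
        cechComponent f d ℳ 0 (w k + β) := fun k β c hc =>
    mem_cechComponent.2 fun I => h.smul_mem_localizedComponent (isWeightedHomogeneous_prod hf I.1)
      (MvPolynomial.isWeightedHomogeneous_X S w k) (mem_cechComponent.1 hc I)
  have hz0 : (toCechZero f M).compLeft _ z ∈ koszulComponent w (cechComponent f d ℳ 0) j γ :=
    compLeft_mem_koszulComponent _ toCechZero_mem hz
  obtain ⟨u, hu, hud⟩ := h.exists_cechDifferential_sub_eq_zero hf hfX hH s 0 j (by omega) (by omega)
    _ hz0 (by rw [koszulD_compLeft, koszulD_compLeft, hdz, map_zero, map_zero])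
  have hmem := sub_mem hz0 (koszulD_mem_koszulComponent hXC hu)
  have hzero : (toCechZero f M).compLeft _ z - ∂ _ u = 0 := by
    ext1 Q
    by_cases hQ : Q.card = j
    · exact mem_cechCoboundaries_of_cohomologyComponent_eq_bot (hH 0 Q (by omega))
        ((hmem Q).1 hQ) (congrFun hud Q)
    · exact (hmem Q).2 hQ
  obtain ⟨y, hy, rfl⟩ := exists_compLeft_eq (toCechZero f M) hu fun Q hQ =>
    h.exists_toCechZero_eq hf ((hu Q).1 hQ)
  refine ⟨y, hy, ?_⟩
  rw [koszulD_compLeft, sub_eq_zero] at hzero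
  exact funext fun Q => (toCechZero_injective (congrFun hzero Q)).symm

end CechDegree

/-! ### Regularity and the degrees of Tor -/

theorem GradedFreeResolution.exists_cohomologyComponent_ne_bot {G : Type*} [AddCommGroup G]
    {n s : ℕ} {S : Type u} [CommRing S] {w : Fin n → G}
    {f : Fin s → MvPolynomial (Fin n) S} {d : Fin s → G}
    {M : Type*} [AddCommGroup M] [Module (MvPolynomial (Fin n) S) M] {ℳ : G → AddSubgroup M}
    (hM : IsGradedModule S w ℳ)
    (hf : ∀ i, MvPolynomial.IsWeightedHomogeneous w (f i) (d i))
    (hfX : ∀ i, f i ∈ Ideal.span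
      (Set.range (MvPolynomial.X : Fin n → MvPolynomial (Fin n) S)))
    (P : GradedFreeResolution.{u, v} S w ℳ) {j : ℕ} {γ : G}
    (hγ : γ ∈ gradedSupport (P.torComponent j)) :
    ∃ (p : ℕ) (Q : Finset (Fin n)), Q.card = p + j ∧
      γ - ∑ i ∈ Q, w i ∈ gradedSupport (cohomologyComponent f d ℳ p) := by
  by_contra! hcon
  exact hγ (P.torComponent_eq_bot hM
    (hM.isKoszulExact_of_cohomologyComponent_eq_bot (f := f) (d := d) hf hfX
      fun p Q hQ => not_not.1 (hcon p Q hQ)))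

end

theorem mainTheorem10 {S : Type u} [CommRing S] {n s : ℕ}
    (B : Ideal (MvPolynomial (Fin n) S))
    (hBX : B ≤ Ideal.span (Set.range (MvPolynomial.X : Fin n → MvPolynomial (Fin n) S)))
    (f : Fin s → MvPolynomial (Fin n) S) (hB : Ideal.span (Set.range f) = B)
    {M : Type x} [AddCommGroup M] [Module (MvPolynomial (Fin n) S) M] :
    (∀ {G : Type y} [AddCommGroup G] (w : Fin n → G) (d : Fin s → G)
        (_ : ∀ i, MvPolynomial.IsWeightedHomogeneous w (f i) (d i))
        (ℳ : G → AddSubgroup M) (_ : IsGradedModule S w ℳ)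
        (P : GradedFreeResolution.{u, v} S w ℳ) (j : ℕ),
        (⋂ γ ∈ sumsOfDistinct w j, (regularityRegion w f d ℳ + {γ})) ∩
          gradedSupport (P.torComponent j) = ∅) ∧
      (∀ (d : Fin s → ℤ)
        (_ : ∀ i, MvPolynomial.IsWeightedHomogeneous (fun _ : Fin n => (1 : ℤ)) (f i) (d i))
        (ℳ : ℤ → AddSubgroup M) (_ : IsGradedModule S (fun _ : Fin n => (1 : ℤ)) ℳ)
        (P : GradedFreeResolution.{u, v} S (fun _ : Fin n => (1 : ℤ)) ℳ) (j : ℕ),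
        gradedEnd (P.torComponent j) ≤
          regularityNumber f d ℳ + (j : WithBot (WithTop ℤ))) := by
  have hfX : ∀ i, f i ∈ Ideal.span
      (Set.range (MvPolynomial.X : Fin n → MvPolynomial (Fin n) S)) :=
    fun i => hBX (hB ▸ Ideal.subset_span ⟨i, rfl⟩)
  refine ⟨fun {G} _ w d hf ℳ hM P j => ?_, fun d hf ℳ hM P j => ?_⟩
  · rw [Set.eq_empty_iff_forall_notMem]
    rintro γ ⟨hreg, hγ⟩
    obtain ⟨p, Q, hQ, hp⟩ := P.exists_cohomologyComponent_ne_bot (d := d) hM hf hfX hγ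
    -- Since `Q` has at least `j` elements, this also covers an empty `ℰ_j`: the support of `Tor` is
    -- then empty.
    obtain ⟨J, hJQ, hJ⟩ := Finset.exists_subset_card_eq (s := Q) (n := j) (by omega)
    obtain ⟨ρ, hρ, _, rfl, rfl⟩ := Set.mem_iInter₂.1 hreg _ ⟨J, hJ, rfl⟩
    -- Weak regularity is needed only at `ρ` itself, with `0 ∈ 𝒞`: here `ρ - ∑ i ∈ Q \ J, w i` lies
    -- in the support of `H^p_B(M)`.
    refine hρ ρ ⟨ρ, rfl, 0, zero_mem _, add_zero _⟩
      (Set.mem_iUnion.2 ⟨p, _, hp, ∑ i ∈ Q \ J, w i, ⟨Q \ J, ?_, rfl⟩, ?_⟩)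
    · rw [Finset.card_sdiff_of_subset hJQ]; omega
    · dsimp only
      rw [← Finset.sum_sdiff hJQ]; abel
  · refine iSup₂_le fun μ hμ => ?_
    obtain ⟨p, Q, hQ, hp⟩ := P.exists_cohomologyComponent_ne_bot (d := d) hM hf hfX hμ
    simp only [Finset.sum_const, hQ, nsmul_eq_mul, mul_one] at hp
    have h1 : (((μ - (p + j : ℕ) : ℤ) : WithTop ℤ) : WithBot (WithTop ℤ)) ≤
        gradedEnd (cohomologyComponent f d ℳ p) :=
      le_iSup₂ (f := fun μ (_ : μ ∈ gradedSupport (cohomologyComponent f d ℳ p)) =>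
        ((μ : WithTop ℤ) : WithBot (WithTop ℤ))) _ hp
    have h2 : gradedEnd (cohomologyComponent f d ℳ p) + (p : WithBot (WithTop ℤ)) ≤
        regularityNumber f d ℳ :=
      le_iSup (fun i : ℕ => gradedEnd (cohomologyComponent f d ℳ i) + (i : WithBot (WithTop ℤ))) p
    refine le_trans (le_of_eq ?_) (add_le_add_left ((add_le_add_left h1 _).trans h2) _)
    have h3 : μ = μ - (p + j : ℕ) + (p : ℤ) + (j : ℤ) := by push_cast; ring
    exact_mod_cast congrArg (fun t : ℤ => ((t : WithTop ℤ) : WithBot (WithTop ℤ))) h3
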